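/- Theorem (Convergence of the minima). Let $N\ge 1$, let $\Omega\subset\mathbb{R}^N$ be a non-empty, open and bounded set with Lipschitz boundary (i.e. near each boundary point, up to a rigid motion, $\Omega$ is the strict epigraph of a Lipschitz function of $N-1$ variables), and let $0<s<1$. For $p\ge 1$ and measurable $u:\mathbb{R}^N\to\mathbb{R}$ put $$[u]_{W^{s,p}(\mathbb{R}^N)}=\left(\int_{\mathbb{R}^N}\int_{\mathbb{R}^N}\frac{|u(x)-u(y)|^p}{|x-y|^{N+s\,p}}\,dx\,dy\right)^{1/p},$$ and let $\widetilde W^{s,p}_0(\Omega)$ be the closure of $C^\infty_0(\Omega)$ (smooth functions with compact support in $\Omega$) with respect to the norm $[u]_{W^{s,p}(\mathbb{R}^N)}+\|u\|_{L^p(\Omega)}$, its elements being extended by $0$ outside $\Omega$. For $p>1$ let $$\lambda^s_{1,p}(\Omega)=\inf\left\{[u]^p_{W^{s,p}(\mathbb{R}^N)}\,:\,u\in\widetilde W^{s,p}_0(\Omega),\ \|u\|_{L^p(\Omega)}=1,\ u\ge 0\right\}$$ be the first nonlocal $p$-eigenvalue of $\Omega$, and let $$h_s(\Omega)=\inf\left\{\frac{P_s(A)}{|A|}\,:\,A\subset\Omega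 \text{ Borel},\ |A|>0\right\},\qquad P_s(A)=[1_A]_{W^{s,1}(\mathbb{R}^N)},$$ be its $s$-Cheeger constant, where $|A|$ is the Lebesgue measure of $A$. Then $h_s(\Omega)<+\infty$ and $$\lim_{p\to1^+}\lambda^s_{1,p}(\Omega)=h_s(\Omega).$$ -/

import Mathlib

open MeasureTheory Filter Topology Set
open scoped ENNReal NNReal ContDiff

noncomputable section

namespace FracCheeger

/-- The Gagliardo seminorm `[u]_{W^{s,p}(ℝ^N)}`, with value `∞` when the double integral diverges.
On the diagonal `x = y` the integrand reads `0 / 0 = 0` in `ℝ≥0∞`. -/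
def gagliardo {N : ℕ} (s p : ℝ) (u : EuclideanSpace ℝ (Fin N) → ℝ) : ℝ≥0∞ :=
  (∫⁻ x, ∫⁻ y, ‖u x - u y‖ₑ ^ p / ‖x - y‖ₑ ^ ((N : ℝ) + s * p)) ^ (1 / p)

/-- The `L^p(Ω)` norm of `u`, with respect to Lebesgue measure. -/
def normLp {N : ℕ} (p : ℝ) (Ω : Set (EuclideanSpace ℝ (Fin N)))
    (u : EuclideanSpace ℝ (Fin N) → ℝ) : ℝ≥0∞ :=
  eLpNorm u (ENNReal.ofReal p) (volume.restrict Ω)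

/-- `φ ∈ C^∞_0(Ω)`: smooth, with compact support contained in `Ω`. -/
def IsTestFunction {N : ℕ} (Ω : Set (EuclideanSpace ℝ (Fin N)))
    (φ : EuclideanSpace ℝ (Fin N) → ℝ) : Prop :=
  ContDiff ℝ ∞ φ ∧ HasCompactSupport φ ∧ tsupport φ ⊆ Ω

/-- `u` (a measurable function, extended by zero outside `Ω`) belongs to `W̃^{s,p}_0(Ω)`, the closure
of `C^∞_0(Ω)` for the norm `u ↦ [u]_{W^{s,p}(ℝ^N)} + ‖u‖_{L^p(Ω)}`. -/
def MemSobolevZero {N : ℕ} (s p : ℝ) (Ω : Set (EuclideanSpace ℝ (Fin N)))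
    (u : EuclideanSpace ℝ (Fin N) → ℝ) : Prop :=
  AEMeasurable u volume ∧ (∀ᵐ x ∂volume, x ∉ Ω → u x = 0) ∧
    ∀ ε : ℝ≥0∞, 0 < ε → ∃ φ, IsTestFunction Ω φ ∧
      gagliardo s p (fun x => u x - φ x) + normLp p Ω (fun x => u x - φ x) < ε

/-- The first nonlocal `p`-eigenvalue `λ^s_{1,p}(Ω)`: the infimum of `[u]^p` over the nonnegative
`u ∈ W̃^{s,p}_0(Ω)` with `‖u‖_{L^p(Ω)} = 1`. -/
def firstEigenvalue {N : ℕ} (s p : ℝ) (Ω : Set (EuclideanSpace ℝ (Fin N))) : ℝ≥0∞ :=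
  ⨅ (u : EuclideanSpace ℝ (Fin N) → ℝ) (_ : MemSobolevZero s p Ω u)
    (_ : normLp p Ω u = 1) (_ : ∀ᵐ x ∂volume, 0 ≤ u x), gagliardo s p u ^ p

/-- The `s`-perimeter `P_s(A) = [1_A]_{W^{s,1}(ℝ^N)}`. -/
def sPerimeter {N : ℕ} (s : ℝ) (A : Set (EuclideanSpace ℝ (Fin N))) : ℝ≥0∞ :=
  gagliardo s 1 (A.indicator (fun _ => (1 : ℝ)))

/-- The `s`-Cheeger constant: the infimum of `P_s(A) / |A|` over the Borel sets `A ⊆ Ω` of positive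
measure. -/
def cheegerConstant {N : ℕ} (s : ℝ) (Ω : Set (EuclideanSpace ℝ (Fin N))) : ℝ≥0∞ :=
  ⨅ (A : Set (EuclideanSpace ℝ (Fin N))) (_ : MeasurableSet A) (_ : A ⊆ Ω) (_ : volume A ≠ 0),
    sPerimeter s A / volume A

/-- `Ω` has Lipschitz boundary: near each boundary point and in the direction of a suitable unit
vector `v`, it is the part lying strictly above the graph of a Lipschitz function defined on the
hyperplane orthogonal to `v`. -/
def HasLipschitzBoundary {N : ℕ} (Ω : Set (EuclideanSpace ℝ (Fin N))) : Prop :=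
  ∀ x₀ ∈ frontier Ω, ∃ (v : EuclideanSpace ℝ (Fin N)) (K : ℝ≥0)
    (g : (Submodule.span ℝ {v})ᗮ → ℝ) (r : ℝ),
      ‖v‖ = 1 ∧ LipschitzWith K g ∧ 0 < r ∧
        ∀ x ∈ Metric.ball x₀ r,
          (x ∈ Ω ↔ g ((Submodule.span ℝ {v})ᗮ.orthogonalProjectionOnto x) < inner ℝ v x)

end FracCheeger

end

/-! Everything is compared with the quotient `[v]_{W^{s,1}} / ‖v‖_{L^1}`. By the coarea argument
(`cheegerConstant_mul_lintegral_le`) it is at least `h_s(Ω)` for nonnegative `v` supported in `Ω`.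
Conversely, test functions nearly attain the quotient of any Borel set `A ⊆ Ω`: the Lipschitz
boundary provides bi-Lipschitz maps, with constant `L` close to `1`, that push `closure Ω` into `Ω`
(`exists_deformation`), so the deformed indicator can be mollified without leaving `Ω`.

Upper bound. A test function satisfies `|φ x - φ y| ≤ M |x - y|^s`, hence `[φ]_p^p ≤ M^(p-1) [φ]_1`
(`gagliardo_rpow_le`). Hölder on `Ω` bounds `‖φ‖_p` from below, and the `p`-quotient is
asymptotically at most the `1`-quotient.

Lower bound. For a competitor `u`, the function `w = u^p` has unit mass, and Young's inequality
(`abs_rpow_sub_rpow_mul_le`) compares its `W^{s,1}` energy with `[u]_p^p`. The error is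
`(p-1)(u(x)^p + u(y)^p)|x-y|^(-N)`, integrable neither at the diagonal nor at infinity, so it is
used only for intermediate distances. Beyond a large `R` the tail of the kernel is small. Below `η`
nothing is known about `w`, but its deformed and mollified version `v` has `L^1` translation modulus
at most a constant times `|z|`, and `|z| |z|^(-N-s)` is integrable at `0`. The coarea inequality is
applied to `v`. The choices are made in the order `L`, mollifier, `η` and `R`, and finally `p → 1`.
-/

noncomputable section

namespace FracCheeger

/-! ### Bi-Lipschitz deformations pushing a domain into itself -/

section Deformation

/-- A contraction perturbation of the identity is a bi-Lipschitz homeomorphism. -/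
lemma exists_homeomorph_id_add {E : Type*} [NormedAddCommGroup E] [NormedSpace ℝ E]
    [CompleteSpace E] {L : ℝ≥0} (hL : 1 < L) {g : E → E} (hg : LipschitzWith (1 - L⁻¹) g) :
    ∃ Φ : E ≃ₜ E, (∀ x, Φ x = x + g x) ∧ LipschitzWith L Φ ∧ LipschitzWith L Φ.symm := by
  have hL0 : (0 : ℝ) < L := by have : (0 : ℝ≥0) < L := zero_lt_one.trans hL; exact_mod_cast this
  have hL1 : (1 : ℝ) < L := by exact_mod_cast hL
  have hinv : L⁻¹ ≤ 1 := inv_le_one_of_one_le₀ hL.le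
  have hinv0 : (0 : ℝ) < (L : ℝ)⁻¹ := inv_pos.2 hL0
  have hcoe : (((1 - L⁻¹ : ℝ≥0)) : ℝ) = 1 - (L : ℝ)⁻¹ := by
    rw [NNReal.coe_sub hinv]; simp
  have hLL : (L : ℝ) * (L : ℝ)⁻¹ = 1 := mul_inv_cancel₀ hL0.ne'
  have hg' : ∀ x y, ‖g x - g y‖ ≤ (1 - (L : ℝ)⁻¹) * ‖x - y‖ := by
    intro x y
    have := hg.dist_le_mul x y
    rwa [dist_eq_norm, dist_eq_norm, hcoe] at this
  have happ : ApproximatesLinearOn (fun x => x + g x)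
      ((ContinuousLinearEquiv.refl ℝ E : E ≃L[ℝ] E) : E →L[ℝ] E) univ (1 - L⁻¹) := by
    intro x _ y _
    have h : x + g x - (y + g y) - (x - y) = g x - g y := by abel
    simp only [ContinuousLinearEquiv.coe_refl, ContinuousLinearMap.coe_id', id_eq]
    rw [h, hcoe]
    exact hg' x y
  have hN : Subsingleton E ∨
      (1 - L⁻¹) < ‖(((ContinuousLinearEquiv.refl ℝ E : E ≃L[ℝ] E).symm : E ≃L[ℝ] E) :
        E →L[ℝ] E)‖₊⁻¹ := by
    rcases subsingleton_or_nontrivial E with h | h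
    · exact Or.inl h
    · right
      have h1 : ‖(((ContinuousLinearEquiv.refl ℝ E : E ≃L[ℝ] E).symm : E ≃L[ℝ] E) :
        E →L[ℝ] E)‖₊ = 1 := by
        ext
        simp
      rw [h1, inv_one]
      rw [← NNReal.coe_lt_coe, hcoe, NNReal.coe_one]
      linarith
  refine ⟨happ.toHomeomorph _ hN, fun x => rfl, ?_, ?_⟩
  · refine LipschitzWith.of_dist_le_mul fun x y => ?_
    change dist (x + g x) (y + g y) ≤ _
    rw [dist_eq_norm, dist_eq_norm]
    have h : x + g x - (y + g y) = (x - y) + (g x - g y) := by abel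
    rw [h]
    -- This is `L + L⁻¹ ≥ 2`. The contraction constant `1 - L⁻¹` is the one for which the inverse
    -- has constant exactly `L`.
    have h2 : (1 : ℝ) + (1 - (L : ℝ)⁻¹) ≤ L := by nlinarith [sq_nonneg ((L : ℝ) - 1)]
    calc _ ≤ ‖x - y‖ + ‖g x - g y‖ := norm_add_le _ _
      _ ≤ (1 + (1 - (L : ℝ)⁻¹)) * ‖x - y‖ := by linarith [hg' x y]
      _ ≤ L * ‖x - y‖ := by gcongr
  · refine LipschitzWith.of_dist_le_mul fun x y => ?_
    set Φ := happ.toHomeomorph _ hN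
    obtain ⟨a, rfl⟩ := Φ.surjective x
    obtain ⟨b, rfl⟩ := Φ.surjective y
    rw [Φ.symm_apply_apply, Φ.symm_apply_apply]
    change dist a b ≤ L * dist (a + g a) (b + g b)
    rw [dist_eq_norm, dist_eq_norm]
    have h : a - b = (a + g a - (b + g b)) - (g a - g b) := by abel
    have h1 := norm_sub_le (a + g a - (b + g b)) (g a - g b)
    rw [← h] at h1
    have h3 : (L : ℝ)⁻¹ * ‖a - b‖ ≤ ‖a + g a - (b + g b)‖ := by linarith [hg' a b]
    calc ‖a - b‖ = L * ((L : ℝ)⁻¹ * ‖a - b‖) := by rw [← mul_assoc, hLL, one_mul]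
      _ ≤ _ := by gcongr

variable {N : ℕ}

/-- A set with Lipschitz boundary can be mapped, together with its closure, into itself by
bi-Lipschitz homeomorphisms whose constants are arbitrarily close to `1`. -/
lemma exists_deformation {Ω : Set (EuclideanSpace ℝ (Fin N))} (hbdd : Bornology.IsBounded Ω)
    (hopen : IsOpen Ω) (hlip : HasLipschitzBoundary Ω) {L : ℝ≥0} (hL : 1 < L) :
    ∃ Φ : EuclideanSpace ℝ (Fin N) ≃ₜ EuclideanSpace ℝ (Fin N),
      LipschitzWith L Φ ∧ LipschitzWith L Φ.symm ∧ ∀ x ∈ closure Ω, Φ x ∈ Ω := by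
  have hcomp : IsCompact (frontier Ω) :=
    hbdd.isCompact_closure.of_isClosed_subset isClosed_frontier frontier_subset_closure
  -- Compactness induction over pieces `S` of the boundary. The alternative `Φ x = x` ensures that a
  -- map treating one piece never expels a point, so maps for different pieces can be composed.
  -- Quantifying over all `L` lets a union spend `√L` on each factor.
  let P : Set (EuclideanSpace ℝ (Fin N)) → Prop := fun S => ∀ L : ℝ≥0, 1 < L →
    ∃ Φ : EuclideanSpace ℝ (Fin N) ≃ₜ EuclideanSpace ℝ (Fin N),
      LipschitzWith L Φ ∧ LipschitzWith L Φ.symm ∧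
        ∀ x ∈ closure Ω, (Φ x ∈ Ω ∨ Φ x = x) ∧ (x ∈ S → Φ x ∈ Ω)
  have key : P (frontier Ω) := by
    refine hcomp.induction_on (p := P) ?_ ?_ ?_ ?_
    · intro L hL
      exact ⟨Homeomorph.refl _, LipschitzWith.id.weaken hL.le, LipschitzWith.id.weaken hL.le,
        fun x _ => ⟨Or.inr rfl, fun h => h.elim⟩⟩
    · intro S T hST hT L hL
      obtain ⟨Φ, h1, h2, h3⟩ := hT L hL
      exact ⟨Φ, h1, h2, fun x hx => ⟨(h3 x hx).1, fun h => (h3 x hx).2 (hST h)⟩⟩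
    · intro S T hS hT L hL
      have hsq : 1 < NNReal.sqrt L := by simpa using NNReal.sqrt_lt_sqrt.2 hL
      obtain ⟨Φ, h1, h2, h3⟩ := hS _ hsq
      obtain ⟨Ψ, k1, k2, k3⟩ := hT _ hsq
      refine ⟨Φ.trans Ψ, ?_, ?_, ?_⟩
      · have := k1.comp h1
        rwa [NNReal.mul_self_sqrt] at this
      · have := h2.comp k2
        rwa [NNReal.mul_self_sqrt] at this
      · intro x hx
        simp only [Homeomorph.trans_apply]
        have hΨ : ∀ y ∈ Ω, Ψ y ∈ Ω := fun y hy => by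
          rcases (k3 y (subset_closure hy)).1 with h | h
          · exact h
          · rwa [h]
        refine ⟨?_, ?_⟩
        · rcases (h3 x hx).1 with h | h
          · exact Or.inl (hΨ _ h)
          · rw [h]; exact (k3 x hx).1
        · rintro (h | h)
          · exact hΨ _ ((h3 x hx).2 h)
          · rcases (h3 x hx).1 with h' | h'
            · exact hΨ _ h'
            · rw [h']; exact (k3 x hx).2 h
    · intro x₀ hx₀
      obtain ⟨v, K, g, r, hv, hg, hr, hgraph⟩ := hlip x₀ hx₀
      refine ⟨Metric.ball x₀ (r / 2),
        mem_nhdsWithin_of_mem_nhds (Metric.ball_mem_nhds _ (by positivity)), ?_⟩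
      intro L hL
      have hL0 : (0 : ℝ≥0) < L := zero_lt_one.trans hL
      have hinv : L⁻¹ ≤ 1 := inv_le_one_of_one_le₀ hL.le
      have hinv1 : L⁻¹ < 1 := inv_lt_one_of_one_lt₀ hL
      set t : ℝ≥0 := 1 - L⁻¹ with ht
      have ht0 : (0 : ℝ) < t := by
        have : 0 < t := tsub_pos_of_lt hinv1
        exact_mod_cast this
      have ht1 : (t : ℝ) < 1 := by
        have : t < 1 := tsub_lt_self one_pos (inv_pos.2 hL0)
        exact_mod_cast this
      -- Height of the push along `v`: positive exactly on the half ball, with slope `t = 1 - L⁻¹`,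
      -- and less than `r / 2`, so that points of the half ball stay where the graph description is
      -- valid.
      let f : EuclideanSpace ℝ (Fin N) → ℝ := fun x => t * max (r / 2 - dist x x₀) 0
      have hf0 : ∀ x, 0 ≤ f x := fun x => mul_nonneg ht0.le (le_max_right _ _)
      have hlipg : LipschitzWith t (fun x => f x • v) := by
        refine LipschitzWith.of_dist_le_mul fun x y => ?_
        rw [dist_eq_norm, ← sub_smul, norm_smul, hv, mul_one, ← mul_sub, norm_mul,
          Real.norm_of_nonneg ht0.le]
        gcongr
        refine (abs_max_sub_max_le_abs _ _ _).trans ?_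
        rw [sub_sub_sub_cancel_left, abs_sub_comm]
        exact abs_dist_sub_le x y x₀
      obtain ⟨Φ, hΦ, h1, h2⟩ := exists_homeomorph_id_add hL hlipg
      have hmove : ∀ x ∈ closure Ω, x ∈ Metric.ball x₀ (r / 2) → Φ x ∈ Ω := by
        intro x hx hxb
        rw [Metric.mem_ball] at hxb
        have hfx : f x = t * (r / 2 - dist x x₀) := by
          simp only [f]; rw [max_eq_left (by linarith)]
        have hfpos : 0 < f x := by rw [hfx]; exact mul_pos ht0 (by linarith)
        have hfle : f x < r / 2 := by
          rw [hfx]; nlinarith [dist_nonneg (x := x) (y := x₀)]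
        have hxr : x ∈ Metric.ball x₀ r := by rw [Metric.mem_ball]; linarith
        -- On the closure only the weak inequality survives; the push along `v` leaves the
        -- projection fixed and makes it strict.
        have hle : g ((Submodule.span ℝ {v})ᗮ.orthogonalProjectionOnto x) ≤ inner ℝ v x := by
          have hcl : x ∈ closure (Ω ∩ Metric.ball x₀ r) := by
            rw [Set.inter_comm]
            exact Metric.isOpen_ball.inter_closure ⟨hxr, hx⟩
          refine closure_minimal (s := Ω ∩ Metric.ball x₀ r)
            (t := {y | g ((Submodule.span ℝ {v})ᗮ.orthogonalProjectionOnto y) ≤ inner ℝ v y})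
            ?_ ?_ hcl
          · rintro y ⟨hy, hyb⟩
            exact ((hgraph y hyb).1 hy).le
          · refine isClosed_le (hg.continuous.comp (ContinuousLinearMap.continuous _)) ?_
            fun_prop
        rw [hΦ]
        refine (hgraph _ ?_).2 ?_
        · rw [Metric.mem_ball]
          calc dist (x + f x • v) x₀ ≤ dist (x + f x • v) x + dist x x₀ := dist_triangle _ _ _
            _ = f x + dist x x₀ := by
              rw [dist_eq_norm, add_sub_cancel_left, norm_smul, hv, mul_one,
                Real.norm_of_nonneg (hf0 x)]
            _ < r := by linarith
        · have hpv : (Submodule.span ℝ {v})ᗮ.orthogonalProjectionOnto v = 0 := by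
            apply Submodule.orthogonalProjectionOnto_apply_of_mem_orthogonal
            rw [Submodule.orthogonal_orthogonal]
            exact Submodule.mem_span_singleton_self v
          rw [map_add, map_smul, hpv, smul_zero, add_zero, inner_add_right, inner_smul_right,
            real_inner_self_eq_norm_sq, hv]
          linarith
      refine ⟨Φ, h1, h2, fun x hx => ⟨?_, hmove x hx⟩⟩
      by_cases hxb : x ∈ Metric.ball x₀ (r / 2)
      · exact Or.inl (hmove x hx hxb)
      · right
        rw [Metric.mem_ball, not_lt] at hxb
        have : f x = 0 := by simp only [f]; rw [max_eq_right (by linarith), mul_zero]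
        rw [hΦ]
        simp [this]
  obtain ⟨Φ, h1, h2, h3⟩ := key L hL
  refine ⟨Φ, h1, h2, fun x hx => ?_⟩
  by_cases hxΩ : x ∈ Ω
  · rcases (h3 x hx).1 with h | h
    · exact h
    · rwa [h]
  · refine (h3 x hx).2 ⟨hx, ?_⟩
    rwa [hopen.interior_eq]

/-- A Lipschitz map increases Lebesgue measure at most by the `N`-th power of its constant. -/
lemma volume_image_le {L : ℝ≥0} {Φ : EuclideanSpace ℝ (Fin N) → EuclideanSpace ℝ (Fin N)}
    (hΦ : LipschitzWith L Φ) (A : Set (EuclideanSpace ℝ (Fin N))) :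
    volume (Φ '' A) ≤ (L : ℝ≥0∞) ^ N * volume A := by
  have : (Measure.hausdorffMeasure (N : ℝ) :
      Measure (EuclideanSpace ℝ (Fin N))).IsAddHaarMeasure := by
    simpa using isAddHaarMeasure_hausdorffMeasure (E := EuclideanSpace ℝ (Fin N))
  -- Lebesgue measure is a multiple of the Hausdorff measure; the value of the factor is irrelevant
  -- because the estimate is homogeneous.
  have h := Measure.isAddLeftInvariant_eq_smul (volume : Measure (EuclideanSpace ℝ (Fin N)))
    (Measure.hausdorffMeasure (N : ℝ))
  rw [h, Measure.smul_apply, Measure.smul_apply, ENNReal.smul_def, ENNReal.smul_def, smul_eq_mul,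
    smul_eq_mul, mul_left_comm]
  have := hΦ.hausdorffMeasure_image_le (Nat.cast_nonneg N : (0 : ℝ) ≤ N) A
  rw [ENNReal.rpow_natCast] at this
  gcongr

/-- Change of variables inequality for a Lipschitz homeomorphism. -/
lemma lintegral_le_lintegral_comp {L : ℝ≥0}
    {Φ : EuclideanSpace ℝ (Fin N) ≃ₜ EuclideanSpace ℝ (Fin N)} (hΦ : LipschitzWith L Φ)
    (f : EuclideanSpace ℝ (Fin N) → ℝ≥0∞) :
    ∫⁻ x, f x ≤ (L : ℝ≥0∞) ^ N * ∫⁻ x, f (Φ x) := by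
  have hle : (volume : Measure (EuclideanSpace ℝ (Fin N))) ≤
      ((L : ℝ≥0∞) ^ N) • Measure.map Φ volume := by
    refine Measure.le_iff.2 fun A hA => ?_
    rw [Measure.smul_apply, smul_eq_mul, Measure.map_apply Φ.continuous.measurable hA]
    have := volume_image_le hΦ (Φ ⁻¹' A)
    rwa [Set.image_preimage_eq A Φ.surjective] at this
  calc ∫⁻ x, f x ≤ ∫⁻ x, f x ∂(((L : ℝ≥0∞) ^ N) • Measure.map Φ volume) := lintegral_mono' hle le_rfl
    _ = _ := by
      rw [lintegral_smul_measure, smul_eq_mul]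
      congr 1
      exact Φ.toMeasurableEquiv.measurableEmbedding.lintegral_map f

end Deformation

/-! ### The modulus of translation and the singular kernel -/

section Kernel

variable {N : ℕ}

/-- The `L^1` modulus of translation of `w`. -/
def translationModulus (w : EuclideanSpace ℝ (Fin N) → ℝ) (z : EuclideanSpace ℝ (Fin N)) :
    ℝ≥0∞ :=
  ∫⁻ x, ‖w (x + z) - w x‖ₑ

/-- The kernel `|z|^{-(N + s)}`. -/
def singularKernel (s : ℝ) (z : EuclideanSpace ℝ (Fin N)) : ℝ≥0∞ :=
  (‖z‖ₑ ^ ((N : ℝ) + s))⁻¹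

@[fun_prop]
lemma measurable_singularKernel (s : ℝ) :
    Measurable (singularKernel s : EuclideanSpace ℝ (Fin N) → ℝ≥0∞) := by
  unfold singularKernel
  fun_prop

/-- Substitute `x = y + z` and use Tonelli. Energies can then be compared through translation
moduli, pointwise in `z`. -/
lemma lintegral_lintegral_diff_mul_kernel {w : EuclideanSpace ℝ (Fin N) → ℝ} (hw : Measurable w)
    {K : EuclideanSpace ℝ (Fin N) → ℝ≥0∞} (hK : Measurable K) :
    ∫⁻ x, ∫⁻ y, ‖w x - w y‖ₑ * K (x - y) = ∫⁻ z, translationModulus w z * K z := by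
  rw [lintegral_lintegral_swap (by fun_prop)]
  have h : ∀ y : EuclideanSpace ℝ (Fin N), ∫⁻ x, ‖w x - w y‖ₑ * K (x - y) =
      ∫⁻ z, ‖w (y + z) - w y‖ₑ * K z := fun y => by
    rw [← lintegral_add_left_eq_self _ y]
    simp only [add_sub_cancel_left]
  simp_rw [h]
  rw [lintegral_lintegral_swap (by fun_prop)]
  refine lintegral_congr fun z => ?_
  rw [lintegral_mul_const _ (by fun_prop), translationModulus]

lemma gagliardo_one (s : ℝ) (u : EuclideanSpace ℝ (Fin N) → ℝ) :
    gagliardo s 1 u = ∫⁻ x, ∫⁻ y, ‖u x - u y‖ₑ * singularKernel s (x - y) := by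
  simp [gagliardo, singularKernel, div_eq_mul_inv]

lemma gagliardo_one_eq {s : ℝ} {u : EuclideanSpace ℝ (Fin N) → ℝ} (hu : Measurable u) :
    gagliardo s 1 u = ∫⁻ z, translationModulus u z * singularKernel s z := by
  rw [gagliardo_one, lintegral_lintegral_diff_mul_kernel hu (measurable_singularKernel s)]

lemma gagliardo_rpow {s p : ℝ} (hp : 0 < p) (u : EuclideanSpace ℝ (Fin N) → ℝ) :
    gagliardo s p u ^ p = ∫⁻ x, ∫⁻ y, ‖u x - u y‖ₑ ^ p / ‖x - y‖ₑ ^ ((N : ℝ) + s * p) := by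
  rw [gagliardo, ← ENNReal.rpow_mul, one_div, inv_mul_cancel₀ hp.ne', ENNReal.rpow_one]

lemma translationModulus_le_two_mul {w : EuclideanSpace ℝ (Fin N) → ℝ} (hw : Measurable w)
    (z : EuclideanSpace ℝ (Fin N)) : translationModulus w z ≤ 2 * ∫⁻ x, ‖w x‖ₑ := by
  calc translationModulus w z ≤ ∫⁻ x, (‖w (x + z)‖ₑ + ‖w x‖ₑ) :=
        lintegral_mono fun x => enorm_sub_le
    _ = (∫⁻ x, ‖w (x + z)‖ₑ) + ∫⁻ x, ‖w x‖ₑ := lintegral_add_right _ (by fun_prop)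
    _ = _ := by rw [lintegral_add_right_eq_self (fun x => ‖w x‖ₑ) z, two_mul]

/-- The difference is at most `C |z|` and vanishes unless `x` or `x + z` lies in the support, a set
of measure at most twice that of the support. -/
lemma exists_translationModulus_le {w : EuclideanSpace ℝ (Fin N) → ℝ} {C : ℝ≥0}
    (hw : LipschitzWith C w) (hc : HasCompactSupport w) :
    ∃ M : ℝ≥0∞, M ≠ ⊤ ∧ ∀ z, translationModulus w z ≤ M * ‖z‖ₑ := by
  have hS : MeasurableSet (tsupport w) := (isClosed_tsupport w).measurableSet
  refine ⟨C * (2 * volume (tsupport w)), ?_, fun z => ?_⟩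
  · have : volume (tsupport w) < ⊤ := IsCompact.measure_lt_top hc
    finiteness
  have hpt : ∀ x, ‖w (x + z) - w x‖ₑ ≤ (C * ‖z‖ₑ) *
      ((tsupport w).indicator 1 (x + z) + (tsupport w).indicator 1 x) := by
    intro x
    by_cases h : x + z ∈ tsupport w ∨ x ∈ tsupport w
    · have h1 : ‖w (x + z) - w x‖ₑ ≤ C * ‖z‖ₑ := by
        have := hw.edist_le_mul (x + z) x
        rwa [edist_eq_enorm_sub, edist_eq_enorm_sub, add_sub_cancel_left] at this
      have h2 : (1 : ℝ≥0∞) ≤ (tsupport w).indicator 1 (x + z) + (tsupport w).indicator 1 x := by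
        rcases h with h | h
        · rw [indicator_of_mem h]; exact le_self_add
        · rw [indicator_of_mem h (f := 1)]; exact le_add_self
      calc _ ≤ (C * ‖z‖ₑ) * 1 := by rwa [mul_one]
        _ ≤ _ := by gcongr
    · push Not at h
      rw [image_eq_zero_of_notMem_tsupport h.1, image_eq_zero_of_notMem_tsupport h.2]
      simp
  have hm : Measurable ((tsupport w).indicator (1 : EuclideanSpace ℝ (Fin N) → ℝ≥0∞)) :=
    measurable_one.indicator hS
  calc translationModulus w z ≤ ∫⁻ x, (C * ‖z‖ₑ) *
      ((tsupport w).indicator 1 (x + z) + (tsupport w).indicator 1 x) := lintegral_mono hpt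
    _ = (C * ‖z‖ₑ) * ((∫⁻ x, (tsupport w).indicator 1 (x + z)) +
        ∫⁻ x, (tsupport w).indicator 1 x) := by
      rw [lintegral_const_mul _ (by fun_prop), lintegral_add_right _ hm]
    _ = _ := by
      rw [lintegral_add_right_eq_self (fun x => (tsupport w).indicator
        (1 : EuclideanSpace ℝ (Fin N) → ℝ≥0∞) x) z,
        lintegral_indicator_one hS]
      ring

/-- In polar coordinates the integrand is `min r 1 * r^(-1-s)`: integrable at `0` because `s < 1`
and at infinity because `0 < s`. -/
lemma lintegral_min_mul_singularKernel_ne_top (hN : 1 ≤ N) {s : ℝ} (hs0 : 0 < s) (hs1 : s < 1) :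
    ∫⁻ z : EuclideanSpace ℝ (Fin N), min ‖z‖ₑ 1 * singularKernel s z ≠ ⊤ := by
  have : Nonempty (Fin N) := ⟨⟨0, hN⟩⟩
  let f : ℝ → ℝ := fun r => min r 1 * r ^ (-((N : ℝ) + s))
  have hreal : IntegrableOn (fun y : ℝ => y ^ (N - 1) • f y) (Ioi 0) := by
    have hpow : ∀ y : ℝ, 0 < y → y ^ (N - 1) • f y = min y 1 * y ^ (-1 - s) := by
      intro y hy
      simp only [f, smul_eq_mul]
      rw [mul_left_comm, ← Real.rpow_natCast, ← Real.rpow_add hy, Nat.cast_sub hN]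
      congr 2
      push_cast
      ring
    rw [← Ioc_union_Ioi_eq_Ioi zero_le_one]
    refine IntegrableOn.union ?_ ?_
    · have h : IntegrableOn (fun y : ℝ => y ^ (-s)) (Ioc 0 1) := by
        rw [← intervalIntegrable_iff_integrableOn_Ioc_of_le zero_le_one]
        exact intervalIntegral.intervalIntegrable_rpow' (by linarith)
      refine h.congr_fun (fun y hy => ?_) measurableSet_Ioc
      simp only
      rw [hpow y hy.1, min_eq_left hy.2]
      nth_rewrite 2 [← Real.rpow_one y]
      rw [← Real.rpow_add hy.1]
      congr 1
      ring
    · refine (integrableOn_Ioi_rpow_of_lt (a := -1 - s) (by linarith) one_pos).congr_fun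
        (fun y hy => ?_) measurableSet_Ioi
      have hy' : (1 : ℝ) < y := hy
      simp only
      rw [hpow y (by linarith), min_eq_right hy'.le, one_mul]
  have hint : Integrable (fun z : EuclideanSpace ℝ (Fin N) => f ‖z‖) := by
    rw [integrable_fun_norm_addHaar]
    simpa using hreal
  have hfin := hint.2
  rw [hasFiniteIntegral_iff_enorm] at hfin
  refine ne_top_of_le_ne_top hfin.ne (lintegral_mono_ae ?_)
  have hz : ∀ᵐ z : EuclideanSpace ℝ (Fin N), z ≠ 0 := by
    simp [ae_iff, measure_singleton]
  filter_upwards [hz] with z hz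
  have hpos : 0 < ‖z‖ := norm_pos_iff.2 hz
  simp only [f, singularKernel]
  rw [enorm_mul, Real.enorm_of_nonneg (le_min hpos.le zero_le_one),
    Real.enorm_of_nonneg (by positivity), Real.rpow_neg hpos.le,
    ENNReal.ofReal_inv_of_pos (by positivity), ← ENNReal.ofReal_rpow_of_pos hpos, ofReal_norm]
  gcongr
  rw [← ofReal_norm, ENNReal.ofReal_min, ENNReal.ofReal_one]

/-- Continuity from above of the finite measure with density `G`, along balls shrinking to the null
set `{0}`; on these balls the minimum is `‖z‖ₑ`. -/
lemma exists_lintegral_near_le (hN : 1 ≤ N) {s : ℝ} (hs0 : 0 < s) (hs1 : s < 1) {δ : ℝ≥0∞}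
    (hδ : δ ≠ 0) : ∃ η : ℝ, 0 < η ∧
      ∫⁻ z in {z : EuclideanSpace ℝ (Fin N) | ‖z‖ ≤ η}, ‖z‖ₑ * singularKernel s z ≤ δ := by
  have : Nonempty (Fin N) := ⟨⟨0, hN⟩⟩
  let G : EuclideanSpace ℝ (Fin N) → ℝ≥0∞ := fun z => min ‖z‖ₑ 1 * singularKernel s z
  have hfin : ∫⁻ z, G z ≠ ⊤ := lintegral_min_mul_singularKernel_ne_top hN hs0 hs1
  let S : ℕ → Set (EuclideanSpace ℝ (Fin N)) := fun n => {z | ‖z‖ ≤ 1 / ((n : ℝ) + 1)}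
  have hSm : ∀ n, MeasurableSet (S n) := fun n => measurableSet_le (by fun_prop) (by fun_prop)
  have hlim := tendsto_measure_iInter_atTop (μ := volume.withDensity G) (s := S)
    (fun n => (hSm n).nullMeasurableSet)
    (fun m n hmn z (hz : _ ≤ _) => show ‖z‖ ≤ 1 / ((m : ℝ) + 1) from
      hz.trans (Nat.one_div_le_one_div hmn))
    ⟨0, by
      rw [withDensity_apply _ (hSm 0)]
      exact ne_top_of_le_ne_top hfin (setLIntegral_le_lintegral _ _)⟩
  have hinter : ⋂ n, S n ⊆ {0} := by
    intro z hz
    rw [mem_iInter] at hz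
    have : ‖z‖ ≤ 0 := ge_of_tendsto' tendsto_one_div_add_atTop_nhds_zero_nat hz
    simpa using this
  have hzero : volume.withDensity G (⋂ n, S n) = 0 :=
    measure_mono_null hinter (withDensity_absolutelyContinuous _ _ (measure_singleton 0))
  rw [hzero] at hlim
  obtain ⟨n, hn⟩ := (hlim.eventually (gt_mem_nhds (pos_iff_ne_zero.2 hδ))).exists
  refine ⟨1 / ((n : ℝ) + 1), by positivity, le_trans (le_of_eq ?_) hn.le⟩
  rw [Function.comp_apply, withDensity_apply _ (hSm n)]
  refine setLIntegral_congr_fun (hSm n) fun z hz => ?_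
  have h1 : ‖z‖ ≤ 1 := le_trans hz (by
    rw [div_le_one (by positivity)]; linarith [(Nat.cast_nonneg n : (0 : ℝ) ≤ n)])
  have h2 : ‖z‖ₑ ≤ 1 := by
    rw [← ofReal_norm]; exact ENNReal.ofReal_le_one.2 h1
  simp only [G]
  rw [min_eq_left h2]

lemma exists_lintegral_far_le (hN : 1 ≤ N) {s : ℝ} (hs0 : 0 < s) (hs1 : s < 1) {δ : ℝ≥0∞}
    (hδ : δ ≠ 0) : ∃ R : ℝ, 0 < R ∧
      ∫⁻ z in {z : EuclideanSpace ℝ (Fin N) | R < ‖z‖}, singularKernel s z ≤ δ := by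
  let G : EuclideanSpace ℝ (Fin N) → ℝ≥0∞ := fun z => min ‖z‖ₑ 1 * singularKernel s z
  have hfin : ∫⁻ z, G z ≠ ⊤ := lintegral_min_mul_singularKernel_ne_top hN hs0 hs1
  let S : ℕ → Set (EuclideanSpace ℝ (Fin N)) := fun n => {z | (n : ℝ) + 1 < ‖z‖}
  have hSm : ∀ n, MeasurableSet (S n) := fun n => measurableSet_lt (by fun_prop) (by fun_prop)
  have hlim := tendsto_measure_iInter_atTop (μ := volume.withDensity G) (s := S)
    (fun n => (hSm n).nullMeasurableSet)
    (fun m n hmn z (hz : (n : ℝ) + 1 < ‖z‖) => show (m : ℝ) + 1 < ‖z‖ from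
      lt_of_le_of_lt (by gcongr) hz)
    ⟨0, by
      rw [withDensity_apply _ (hSm 0)]
      exact ne_top_of_le_ne_top hfin (setLIntegral_le_lintegral _ _)⟩
  have hinter : ⋂ n, S n = ∅ := by
    refine eq_empty_of_forall_notMem fun z hz => ?_
    rw [mem_iInter] at hz
    obtain ⟨n, hn⟩ := exists_nat_gt ‖z‖
    have : (n : ℝ) + 1 < ‖z‖ := hz n
    linarith
  rw [hinter, measure_empty] at hlim
  obtain ⟨n, hn⟩ := (hlim.eventually (gt_mem_nhds (pos_iff_ne_zero.2 hδ))).exists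
  refine ⟨(n : ℝ) + 1, by positivity, le_trans (le_of_eq ?_) hn.le⟩
  rw [Function.comp_apply, withDensity_apply _ (hSm n)]
  refine setLIntegral_congr_fun (hSm n) fun z (hz : (n : ℝ) + 1 < ‖z‖) => ?_
  have h2 : 1 ≤ ‖z‖ₑ := by
    rw [← ofReal_norm]
    exact ENNReal.one_le_ofReal.2 (by linarith [(Nat.cast_nonneg n : (0 : ℝ) ≤ n)])
  simp only [G]
  rw [min_eq_right h2, one_mul]

/-- The translation modulus is at most a multiple of `min |z| 1`: Lipschitz bound for small `z`,
twice the `L^1` norm for large `z`. -/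
lemma gagliardo_one_ne_top (hN : 1 ≤ N) {s : ℝ} (hs0 : 0 < s) (hs1 : s < 1)
    {φ : EuclideanSpace ℝ (Fin N) → ℝ} (hφ : ContDiff ℝ ∞ φ) (hc : HasCompactSupport φ) :
    gagliardo s 1 φ ≠ ⊤ := by
  obtain ⟨C, hC⟩ := ContDiff.lipschitzWith_of_hasCompactSupport hc hφ (by simp)
  obtain ⟨M, hM, hMz⟩ := exists_translationModulus_le hC hc
  have hint : ∫⁻ x, ‖φ x‖ₑ ≠ ⊤ := (hφ.continuous.integrable_of_hasCompactSupport hc).2.ne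
  rw [gagliardo_one_eq hφ.continuous.measurable]
  refine ne_top_of_le_ne_top (b := (M + 2 * ∫⁻ x, ‖φ x‖ₑ) *
    ∫⁻ z : EuclideanSpace ℝ (Fin N), min ‖z‖ₑ 1 * singularKernel s z) ?_ ?_
  · have := lintegral_min_mul_singularKernel_ne_top hN hs0 hs1
    finiteness
  · rw [← lintegral_const_mul _ (by fun_prop)]
    refine lintegral_mono fun z => ?_
    rw [← mul_assoc]
    gcongr
    rcases le_total ‖z‖ₑ 1 with h | h
    · rw [min_eq_left h]
      exact (hMz z).trans (by gcongr; exact le_self_add)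
    · rw [min_eq_right h, mul_one]
      exact (translationModulus_le_two_mul hφ.continuous.measurable z).trans le_add_self

end Kernel

/-! ### Mollification -/

section Mollify

variable {N : ℕ}

open ContinuousLinearMap in
/-- The convolution of `w` with a normalized bump function. -/
def mollify (ρ : ContDiffBump (0 : EuclideanSpace ℝ (Fin N)))
    (w : EuclideanSpace ℝ (Fin N) → ℝ) : EuclideanSpace ℝ (Fin N) → ℝ :=
  convolution (ρ.normed volume) w (lsmul ℝ ℝ) volume

variable (ρ : ContDiffBump (0 : EuclideanSpace ℝ (Fin N))) {w : EuclideanSpace ℝ (Fin N) → ℝ}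

lemma mollify_apply (x : EuclideanSpace ℝ (Fin N)) :
    mollify ρ w x = ∫ t, ρ.normed volume t * w (x - t) := rfl

lemma mollify_apply_swap (x : EuclideanSpace ℝ (Fin N)) :
    mollify ρ w x = ∫ t, ρ.normed volume (x - t) * w t := by
  rw [mollify, convolution_eq_swap]; rfl

lemma contDiff_mollify (hw : Integrable w) : ContDiff ℝ ∞ (mollify ρ w) :=
  ρ.hasCompactSupport_normed.contDiff_convolution_left _ ρ.contDiff_normed hw.locallyIntegrable

lemma integrable_mollify_integrand (hw : Integrable w) (x : EuclideanSpace ℝ (Fin N)) :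
    Integrable (fun t => ρ.normed volume t * w (x - t)) :=
  ρ.hasCompactSupport_normed.convolutionExists_left (ContinuousLinearMap.lsmul ℝ ℝ)
    ρ.continuous_normed hw.locallyIntegrable x

lemma integrable_mollify_integrand_swap (hw : Integrable w) (x : EuclideanSpace ℝ (Fin N)) :
    Integrable (fun t => ρ.normed volume (x - t) * w t) := by
  have := (integrable_mollify_integrand ρ hw x).comp_sub_left x
  simpa using this

lemma mollify_nonneg (hw : ∀ x, 0 ≤ w x) (x : EuclideanSpace ℝ (Fin N)) : 0 ≤ mollify ρ w x :=
  integral_nonneg fun _ => mul_nonneg (ρ.nonneg_normed _) (hw _)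

lemma integrable_mollify (hw : Integrable w) : Integrable (mollify ρ w) :=
  ρ.integrable_normed.integrable_convolution _ hw

/-- Nonnegativity excludes cancellation, so convolving with a kernel of mass `1` leaves the
denominator of the quotient unchanged. -/
lemma lintegral_enorm_mollify (hw : Integrable w) (hw0 : ∀ x, 0 ≤ w x) :
    ∫⁻ x, ‖mollify ρ w x‖ₑ = ∫⁻ x, ‖w x‖ₑ := by
  have h := integral_convolution (ContinuousLinearMap.lsmul ℝ ℝ)
    (ρ.integrable_normed (μ := volume)) hw
  rw [ρ.integral_normed] at h
  have h1 : ∫ x, mollify ρ w x = ∫ x, w x := by simpa [mollify] using h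
  simp_rw [Real.enorm_of_nonneg (mollify_nonneg ρ hw0 _), Real.enorm_of_nonneg (hw0 _)]
  rw [← ofReal_integral_eq_lintegral_ofReal (integrable_mollify ρ hw)
      (ae_of_all _ (mollify_nonneg ρ hw0)),
    ← ofReal_integral_eq_lintegral_ofReal hw (ae_of_all _ hw0), h1]

lemma lintegral_enorm_normed : ∫⁻ x, ‖ρ.normed volume x‖ₑ = 1 := by
  simp_rw [Real.enorm_of_nonneg (ρ.nonneg_normed _)]
  rw [← ofReal_integral_eq_lintegral_ofReal ρ.integrable_normed
      (ae_of_all _ ρ.nonneg_normed), ρ.integral_normed, ENNReal.ofReal_one]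

/-- The mollification is an average of translates of `w`, all having the same modulus. -/
lemma translationModulus_mollify_le (hw : Integrable w) (hwm : Measurable w)
    (z : EuclideanSpace ℝ (Fin N)) :
    translationModulus (mollify ρ w) z ≤ translationModulus w z := by
  have hρm : Measurable (ρ.normed (volume : Measure (EuclideanSpace ℝ (Fin N)))) :=
    ρ.continuous_normed.measurable
  calc translationModulus (mollify ρ w) z
      ≤ ∫⁻ x, ∫⁻ t, ‖ρ.normed volume t‖ₑ * ‖w (x + z - t) - w (x - t)‖ₑ := by
        refine lintegral_mono fun x => ?_
        rw [mollify_apply, mollify_apply, ← integral_sub (integrable_mollify_integrand ρ hw _)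
          (integrable_mollify_integrand ρ hw _)]
        refine (enorm_integral_le_lintegral_enorm _).trans (le_of_eq ?_)
        refine lintegral_congr fun t => ?_
        rw [← mul_sub, enorm_mul]
    _ = ∫⁻ t, ∫⁻ x, ‖ρ.normed volume t‖ₑ * ‖w (x + z - t) - w (x - t)‖ₑ :=
        lintegral_lintegral_swap (by fun_prop)
    _ = ∫⁻ t, ‖ρ.normed volume t‖ₑ * translationModulus w z := by
        refine lintegral_congr fun t => ?_
        rw [lintegral_const_mul _ (by fun_prop), translationModulus,
          ← lintegral_sub_right_eq_self (fun x => ‖w (x + z) - w x‖ₑ) t]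
        simp_rw [sub_add_eq_add_sub]
    _ = translationModulus w z := by
        rw [lintegral_mul_const _ (by fun_prop), lintegral_enorm_normed, one_mul]

/-- Here the difference falls on the mollifier instead. This gives decay in `z` from the mass of `w`
alone, which controls the energy near the diagonal. -/
lemma translationModulus_mollify_le_mul (hw : Integrable w) (hwm : Measurable w)
    (z : EuclideanSpace ℝ (Fin N)) :
    translationModulus (mollify ρ w) z ≤
      translationModulus (ρ.normed volume) z * ∫⁻ x, ‖w x‖ₑ := by
  have hρm : Measurable (ρ.normed (volume : Measure (EuclideanSpace ℝ (Fin N)))) :=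
    ρ.continuous_normed.measurable
  calc translationModulus (mollify ρ w) z
      ≤ ∫⁻ x, ∫⁻ t, ‖ρ.normed volume (x + z - t) - ρ.normed volume (x - t)‖ₑ * ‖w t‖ₑ := by
        refine lintegral_mono fun x => ?_
        rw [mollify_apply_swap, mollify_apply_swap,
          ← integral_sub (integrable_mollify_integrand_swap ρ hw _)
          (integrable_mollify_integrand_swap ρ hw _)]
        refine (enorm_integral_le_lintegral_enorm _).trans (le_of_eq ?_)
        refine lintegral_congr fun t => ?_
        rw [← sub_mul, enorm_mul]
    _ = ∫⁻ t, ∫⁻ x, ‖ρ.normed volume (x + z - t) - ρ.normed volume (x - t)‖ₑ * ‖w t‖ₑ :=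
        lintegral_lintegral_swap (by fun_prop)
    _ = ∫⁻ t, translationModulus (ρ.normed volume) z * ‖w t‖ₑ := by
        refine lintegral_congr fun t => ?_
        rw [lintegral_mul_const _ (by fun_prop), translationModulus,
          ← lintegral_sub_right_eq_self
            (fun x => ‖ρ.normed volume (x + z) - ρ.normed volume x‖ₑ) t]
        simp_rw [sub_add_eq_add_sub]
    _ = _ := lintegral_const_mul _ (by fun_prop)

lemma exists_translationModulus_normed_le :
    ∃ M : ℝ≥0∞, M ≠ ⊤ ∧ ∀ z, translationModulus (ρ.normed volume) z ≤ M * ‖z‖ₑ := by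
  obtain ⟨C, hC⟩ := ContDiff.lipschitzWith_of_hasCompactSupport ρ.hasCompactSupport_normed
    (ρ.contDiff_normed (μ := volume) (n := 1)) one_ne_zero
  exact exists_translationModulus_le hC ρ.hasCompactSupport_normed

lemma isTestFunction_mollify {Ω K : Set (EuclideanSpace ℝ (Fin N))} (hw : Integrable w)
    (hK : IsCompact K) (hwK : Function.support w ⊆ K) {ε : ℝ} (hε : ρ.rOut ≤ ε)
    (hsub : Metric.cthickening ε K ⊆ Ω) : IsTestFunction Ω (mollify ρ w) := by
  have hsupp : Function.support (mollify ρ w) ⊆ Metric.cthickening ε K := by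
    refine (support_convolution_subset _).trans ?_
    rintro _ ⟨a, ha, b, hb, rfl⟩
    rw [ρ.support_normed_eq, Metric.mem_ball, dist_zero_right] at ha
    refine Metric.mem_cthickening_of_dist_le _ b _ _ (hwK hb) ?_
    rw [dist_eq_norm, add_sub_cancel_right]
    linarith
  have ht : tsupport (mollify ρ w) ⊆ Metric.cthickening ε K :=
    closure_minimal hsupp Metric.isClosed_cthickening
  exact ⟨contDiff_mollify ρ hw, hK.cthickening.of_isClosed_subset (isClosed_tsupport _) ht,
    ht.trans hsub⟩

end Mollify

/-! ### The coarea inequality -/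

section Coarea

variable {N : ℕ}

/-- The nonlocal coarea formula yields a Cheeger inequality for functions. -/
lemma cheegerConstant_mul_lintegral_le {s : ℝ} {Ω : Set (EuclideanSpace ℝ (Fin N))}
    (hΩ : volume Ω ≠ ⊤) {v : EuclideanSpace ℝ (Fin N) → ℝ} (hv : Measurable v)
    (hv0 : ∀ x, 0 ≤ v x) (hvΩ : ∀ x, x ∉ Ω → v x = 0) :
    cheegerConstant s Ω * ∫⁻ x, ‖v x‖ₑ ≤ gagliardo s 1 v := by
  let A : ℝ → Set (EuclideanSpace ℝ (Fin N)) := fun t => {x | t < v x}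
  let f : ℝ → EuclideanSpace ℝ (Fin N) → ℝ := fun t => (A t).indicator fun _ => (1 : ℝ)
  have hA : ∀ t, MeasurableSet (A t) := fun t => measurableSet_lt measurable_const hv
  have hS : MeasurableSet {q : ℝ × EuclideanSpace ℝ (Fin N) | q.1 < v q.2} :=
    measurableSet_lt measurable_fst (hv.comp measurable_snd)
  have hf : Measurable (Function.uncurry f) :=
    (measurable_const (a := (1 : ℝ))).indicator hS
  -- For `t > 0` the superlevel set lies in `Ω`, hence competes in the Cheeger constant unless it is
  -- null.
  have hlevel : ∀ t ∈ Ioi (0 : ℝ), cheegerConstant s Ω * volume (A t) ≤ sPerimeter s (A t) := by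
    intro t ht
    have hsub : A t ⊆ Ω := by
      intro x hx
      by_contra hxΩ
      have : t < v x := hx
      rw [hvΩ x hxΩ] at this
      exact absurd this (not_lt.2 (le_of_lt ht))
    by_cases h0 : volume (A t) = 0
    · simp [h0]
    have htop : volume (A t) ≠ ⊤ := ne_top_of_le_ne_top hΩ (measure_mono hsub)
    rw [← ENNReal.le_div_iff_mul_le (Or.inl h0) (Or.inl htop)]
    exact iInf₂_le_of_le (A t) (hA t) (iInf₂_le_of_le hsub h0 le_rfl)
  have hlayer : ∀ x, ‖v x‖ₑ = ∫⁻ t in Ioi (0 : ℝ), (A t).indicator 1 x := by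
    intro x
    have : ∀ t, (A t).indicator (1 : EuclideanSpace ℝ (Fin N) → ℝ≥0∞) x =
        (Iio (v x)).indicator 1 t := fun t => by
      by_cases h : t < v x <;> simp [A, indicator, h]
    simp_rw [this]
    rw [lintegral_indicator_one measurableSet_Iio, Measure.restrict_apply measurableSet_Iio,
      Iio_inter_Ioi, Real.volume_Ioo, sub_zero, Real.enorm_of_nonneg (hv0 x)]
  -- The two indicators differ exactly for the levels `t` separating the two values. Only this half
  -- of the coarea formula is needed.
  have hdiff : ∀ x y, ∫⁻ t in Ioi (0 : ℝ), ‖f t x - f t y‖ₑ ≤ ‖v x - v y‖ₑ := by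
    intro x y
    calc ∫⁻ t in Ioi (0 : ℝ), ‖f t x - f t y‖ₑ ≤ ∫⁻ t, ‖f t x - f t y‖ₑ :=
          setLIntegral_le_lintegral _ _
      _ ≤ ∫⁻ t, (Ico (min (v x) (v y)) (max (v x) (v y))).indicator 1 t := by
          refine lintegral_mono fun t => ?_
          by_cases hx : t < v x <;> by_cases hy : t < v y <;>
            simp [f, A, indicator, hx, hy, not_lt.1]
      _ = _ := by
          rw [lintegral_indicator_one measurableSet_Ico, Real.volume_Ico, max_sub_min_eq_abs',
            Real.enorm_eq_ofReal_abs]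
  calc cheegerConstant s Ω * ∫⁻ x, ‖v x‖ₑ
      = cheegerConstant s Ω * ∫⁻ t in Ioi (0 : ℝ), volume (A t) := by
        congr 1
        simp_rw [hlayer]
        rw [lintegral_lintegral_swap]
        · exact lintegral_congr fun t => lintegral_indicator_one (hA t)
        · exact (((measurable_const (a := (1 : ℝ≥0∞))).indicator hS).comp
            measurable_swap).aemeasurable
    _ ≤ ∫⁻ t in Ioi (0 : ℝ), cheegerConstant s Ω * volume (A t) := lintegral_const_mul_le _ _
    _ ≤ ∫⁻ t in Ioi (0 : ℝ), sPerimeter s (A t) := setLIntegral_mono' measurableSet_Ioi hlevel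
    _ = ∫⁻ t in Ioi (0 : ℝ), ∫⁻ x, ∫⁻ y, ‖f t x - f t y‖ₑ * singularKernel s (x - y) :=
        lintegral_congr fun t => gagliardo_one _ _
    _ = ∫⁻ x, ∫⁻ y, ∫⁻ t in Ioi (0 : ℝ), ‖f t x - f t y‖ₑ * singularKernel s (x - y) := by
        have hm : Measurable fun q : (ℝ × EuclideanSpace ℝ (Fin N)) × EuclideanSpace ℝ (Fin N) =>
            ‖f q.1.1 q.1.2 - f q.1.1 q.2‖ₑ * singularKernel s (q.1.2 - q.2) := by
          have h1 : Measurable fun q : (ℝ × EuclideanSpace ℝ (Fin N)) ×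
              EuclideanSpace ℝ (Fin N) => f q.1.1 q.1.2 := hf.comp measurable_fst
          have h2 : Measurable fun q : (ℝ × EuclideanSpace ℝ (Fin N)) ×
              EuclideanSpace ℝ (Fin N) => f q.1.1 q.2 :=
            hf.comp (f := fun q : (ℝ × EuclideanSpace ℝ (Fin N)) × EuclideanSpace ℝ (Fin N) =>
              (q.1.1, q.2)) (by fun_prop)
          fun_prop
        rw [lintegral_lintegral_swap hm.lintegral_prod_right'.aemeasurable]
        refine lintegral_congr fun x => ?_
        rw [lintegral_lintegral_swap]
        exact (hm.comp (f := fun q : ℝ × EuclideanSpace ℝ (Fin N) => ((q.1, x), q.2))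
          (by fun_prop)).aemeasurable
    _ ≤ ∫⁻ x, ∫⁻ y, ‖v x - v y‖ₑ * singularKernel s (x - y) := by
        refine lintegral_mono fun x => lintegral_mono fun y => ?_
        have h1 : Measurable fun t => f t x := hf.comp measurable_prodMk_right
        have h2 : Measurable fun t => f t y := hf.comp measurable_prodMk_right
        simp only
        rw [lintegral_mul_const _ (by fun_prop)]
        gcongr
        exact hdiff x y
    _ = gagliardo s 1 v := (gagliardo_one _ _).symm

end Coarea

/-! ### Deformation of the truncated Gagliardo energy -/

section DeformEnergy

variable {N : ℕ}

/-- The kernel `|z|^{-(N + s)}` restricted to `|z| > η`. -/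
def truncatedKernel (s η : ℝ) : EuclideanSpace ℝ (Fin N) → ℝ≥0∞ :=
  {z | η < ‖z‖}.indicator (singularKernel s)

@[fun_prop]
lemma measurable_truncatedKernel (s η : ℝ) :
    Measurable (truncatedKernel s η : EuclideanSpace ℝ (Fin N) → ℝ≥0∞) :=
  (measurable_singularKernel s).indicator (measurableSet_lt (by fun_prop) (by fun_prop))

lemma truncatedKernel_le {s η : ℝ} (hs0 : 0 < s) {L : ℝ≥0} (hL : 1 < L)
    {x y : EuclideanSpace ℝ (Fin N)} (h1 : ‖x‖ ≤ L * ‖y‖) (h2 : ‖y‖ ≤ L * ‖x‖) :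
    truncatedKernel s η x ≤ (L : ℝ≥0∞) ^ ((N : ℝ) + s) * truncatedKernel s (η / L) y := by
  have hL0 : 0 < L := zero_lt_one.trans hL
  have hL0' : (0 : ℝ) < L := by exact_mod_cast hL0
  by_cases hx : η < ‖x‖
  · have hy : η / L < ‖y‖ := by
      rw [div_lt_iff₀ hL0', mul_comm]; exact hx.trans_le h1
    rw [truncatedKernel, truncatedKernel, indicator_of_mem (show x ∈ {z | η < ‖z‖} from hx),
      indicator_of_mem (show y ∈ {z | η / L < ‖z‖} from hy), singularKernel, singularKernel]
    have h2' : ‖y‖ₑ ≤ L * ‖x‖ₑ := by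
      have h2'' : ‖y‖₊ ≤ L * ‖x‖₊ := h2
      simp only [enorm_eq_nnnorm]
      exact_mod_cast h2''
    have hpow : ‖y‖ₑ ^ ((N : ℝ) + s) ≤ (L : ℝ≥0∞) ^ ((N : ℝ) + s) * ‖x‖ₑ ^ ((N : ℝ) + s) := by
      rw [← ENNReal.mul_rpow_of_nonneg _ _ (by positivity)]
      gcongr
    have hLne : (L : ℝ≥0∞) ^ ((N : ℝ) + s) ≠ 0 := by
      simp [ENNReal.rpow_eq_zero_iff, hL0.ne']
    have hLtop : (L : ℝ≥0∞) ^ ((N : ℝ) + s) ≠ ⊤ := by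
      exact ENNReal.rpow_ne_top_of_nonneg (by positivity) ENNReal.coe_ne_top
    calc (‖x‖ₑ ^ ((N : ℝ) + s))⁻¹
        = (L : ℝ≥0∞) ^ ((N : ℝ) + s) *
          ((L : ℝ≥0∞) ^ ((N : ℝ) + s) * ‖x‖ₑ ^ ((N : ℝ) + s))⁻¹ := by
          rw [ENNReal.mul_inv (Or.inl hLne) (Or.inl hLtop), ← mul_assoc,
            ENNReal.mul_inv_cancel hLne hLtop, one_mul]
      _ ≤ _ := by gcongr
  · rw [truncatedKernel, indicator_of_notMem (show x ∉ {z | η < ‖z‖} from hx)]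
    exact zero_le

lemma lintegral_enorm_comp_symm_le {L : ℝ≥0}
    {Φ : EuclideanSpace ℝ (Fin N) ≃ₜ EuclideanSpace ℝ (Fin N)} (h1 : LipschitzWith L Φ)
    (w : EuclideanSpace ℝ (Fin N) → ℝ) :
    ∫⁻ x, ‖w (Φ.symm x)‖ₑ ≤ (L : ℝ≥0∞) ^ N * ∫⁻ x, ‖w x‖ₑ := by
  simpa using lintegral_le_lintegral_comp h1 (fun x => ‖w (Φ.symm x)‖ₑ)

/-- Each change of variables costs `L^N`, and the kernel costs `L^(N+s)`. Distances may shrink by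
the factor `L`, so the cutoff drops to `η / L`. -/
lemma lintegral_truncatedKernel_comp_symm_le {s η : ℝ} (hs0 : 0 < s) {L : ℝ≥0} (hL : 1 < L)
    {Φ : EuclideanSpace ℝ (Fin N) ≃ₜ EuclideanSpace ℝ (Fin N)} (h1 : LipschitzWith L Φ)
    (h2 : LipschitzWith L Φ.symm) (w : EuclideanSpace ℝ (Fin N) → ℝ) :
    ∫⁻ x, ∫⁻ y, ‖w (Φ.symm x) - w (Φ.symm y)‖ₑ * truncatedKernel s η (x - y) ≤
      (L : ℝ≥0∞) ^ N * ((L : ℝ≥0∞) ^ N * (L : ℝ≥0∞) ^ ((N : ℝ) + s)) *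
        ∫⁻ x, ∫⁻ y, ‖w x - w y‖ₑ * truncatedKernel s (η / L) (x - y) := by
  have hC : (L : ℝ≥0∞) ^ N * (L : ℝ≥0∞) ^ ((N : ℝ) + s) ≠ ⊤ :=
    ENNReal.mul_ne_top (by finiteness)
      (ENNReal.rpow_ne_top_of_nonneg (by positivity) ENNReal.coe_ne_top)
  have hC' : (L : ℝ≥0∞) ^ ((N : ℝ) + s) ≠ ⊤ :=
    ENNReal.rpow_ne_top_of_nonneg (by positivity) ENNReal.coe_ne_top
  refine (lintegral_le_lintegral_comp h1 _).trans ?_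
  rw [mul_assoc, ← lintegral_const_mul' _ _ hC]
  gcongr with x
  refine (lintegral_le_lintegral_comp h1 _).trans ?_
  rw [mul_assoc, ← lintegral_const_mul' _ _ hC']
  refine mul_le_mul_right (lintegral_mono fun y => ?_) _
  simp only
  rw [Φ.symm_apply_apply, Φ.symm_apply_apply, mul_left_comm]
  gcongr
  refine truncatedKernel_le hs0 hL ?_ ?_
  · simpa [dist_eq_norm] using h1.dist_le_mul x y
  · simpa [dist_eq_norm] using h2.dist_le_mul (Φ x) (Φ y)

end DeformEnergy

/-! ### Regularization by deformation and mollification -/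

section Regularize

variable {N : ℕ}

/-- A deformation into `Ω` followed by a mollification turns functions supported in `Ω` into test
functions. -/
lemma exists_regularization {Ω : Set (EuclideanSpace ℝ (Fin N))} (hbdd : Bornology.IsBounded Ω)
    (hopen : IsOpen Ω) (hlip : HasLipschitzBoundary Ω) {L : ℝ≥0} (hL : 1 < L) :
    ∃ (Φ : EuclideanSpace ℝ (Fin N) ≃ₜ EuclideanSpace ℝ (Fin N))
      (ρ : ContDiffBump (0 : EuclideanSpace ℝ (Fin N))),
      LipschitzWith L Φ ∧ LipschitzWith L Φ.symm ∧
        ∀ w : EuclideanSpace ℝ (Fin N) → ℝ, Integrable (fun x => w (Φ.symm x)) →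
          (∀ x, x ∉ Ω → w x = 0) → IsTestFunction Ω (mollify ρ fun x => w (Φ.symm x)) := by
  obtain ⟨Φ, h1, h2, h3⟩ := exists_deformation hbdd hopen hlip hL
  have hK : IsCompact (Φ '' closure Ω) := hbdd.isCompact_closure.image Φ.continuous
  have hKΩ : Φ '' closure Ω ⊆ Ω := by
    rintro _ ⟨x, hx, rfl⟩
    exact h3 x hx
  obtain ⟨ε, hε, hεΩ⟩ := hK.exists_cthickening_subset_open hopen hKΩ
  -- The outer radius of the bump is the width by which the compact image of `closure Ω` can be
  -- thickened inside `Ω`; the inner radius is arbitrary.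
  refine ⟨Φ, ⟨ε / 2, ε, by positivity, by linarith⟩, h1, h2, fun w hw hwΩ => ?_⟩
  refine isTestFunction_mollify _ hw hK (fun x hx => ?_) le_rfl hεΩ
  refine ⟨Φ.symm x, subset_closure ?_, Φ.apply_symm_apply x⟩
  by_contra hxΩ
  exact hx (hwΩ _ hxΩ)

lemma integrable_comp_symm {L : ℝ≥0}
    {Φ : EuclideanSpace ℝ (Fin N) ≃ₜ EuclideanSpace ℝ (Fin N)} (h1 : LipschitzWith L Φ)
    {w : EuclideanSpace ℝ (Fin N) → ℝ} (hwm : Measurable w) (hw : Integrable w) :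
    Integrable (fun x => w (Φ.symm x)) := by
  refine ⟨(hwm.comp Φ.symm.continuous.measurable).aestronglyMeasurable, ?_⟩
  rw [hasFiniteIntegral_iff_enorm]
  refine (lintegral_enorm_comp_symm_le h1 w).trans_lt ?_
  have := hw.2
  rw [hasFiniteIntegral_iff_enorm] at this
  finiteness

/-- The distortion of the Rayleigh quotient under a bi-Lipschitz map of constant `L`. -/
def distortion (N : ℕ) (s : ℝ) (L : ℝ≥0) : ℝ≥0∞ :=
  (L : ℝ≥0∞) ^ N * ((L : ℝ≥0∞) ^ N * ((L : ℝ≥0∞) ^ N * (L : ℝ≥0∞) ^ ((N : ℝ) + s)))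

lemma distortion_ne_top {s : ℝ} (hs0 : 0 < s) (L : ℝ≥0) : distortion N s L ≠ ⊤ := by
  have hC' : (L : ℝ≥0∞) ^ ((N : ℝ) + s) ≠ ⊤ :=
    ENNReal.rpow_ne_top_of_nonneg (by positivity) ENNReal.coe_ne_top
  unfold distortion
  finiteness

/-- The distortion is continuous in `L` and equals `1` at `L = 1`, so any strict inequality absorbs
it. -/
lemma exists_distortion_mul_lt {s : ℝ} (hs0 : 0 < s) {a b : ℝ≥0∞} (hab : a < b) :
    ∃ L : ℝ≥0, 1 < L ∧ distortion N s L * a < b := by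
  have hcont : Continuous (distortion N s) := by
    have h : Continuous fun L : ℝ≥0 => L ^ N * (L ^ N * (L ^ N * L ^ ((N : ℝ) + s))) := by
      have : Continuous fun L : ℝ≥0 => L ^ ((N : ℝ) + s) :=
        NNReal.continuous_rpow_const (by positivity)
      fun_prop
    have h2 := ENNReal.continuous_coe.comp h
    refine h2.congr fun L => ?_
    simp only [Function.comp_apply, distortion]
    push_cast
    rw [ENNReal.coe_rpow_of_nonneg _ (by positivity : (0 : ℝ) ≤ (N : ℝ) + s)]
  have h1 : distortion N s 1 = 1 := by simp [distortion]
  have hlim : Tendsto (fun L : ℝ≥0 => distortion N s L * a) (𝓝[>] 1) (𝓝 a) := by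
    have := ENNReal.Tendsto.mul_const (b := a)
      ((hcont.tendsto 1).mono_left (nhdsWithin_le_nhds (s := Ioi 1)))
      (Or.inr hab.ne_top)
    rwa [h1, one_mul] at this
  obtain ⟨L, hL⟩ := ((hlim.eventually (gt_mem_nhds hab)).and self_mem_nhdsWithin).exists
  exact ⟨L, hL.2, hL.1⟩

end Regularize

/-! ### The upper bound -/

section Upper

variable {N : ℕ}

/-- With a negative cutoff, the deformation estimate for truncated energies also covers the full
energy. -/
lemma truncatedKernel_of_neg {s η : ℝ} (hη : η < 0) :
    (truncatedKernel s η : EuclideanSpace ℝ (Fin N) → ℝ≥0∞) = singularKernel s := by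
  funext z
  rw [truncatedKernel, indicator_of_mem
    (show z ∈ {z | η < ‖z‖} from hη.trans_le (norm_nonneg z))]

/-- The Rayleigh quotient of a Borel set is almost attained by a test function. -/
lemma exists_isTestFunction_gagliardo_le {Ω : Set (EuclideanSpace ℝ (Fin N))}
    (hbdd : Bornology.IsBounded Ω) (hopen : IsOpen Ω) (hlip : HasLipschitzBoundary Ω) {s : ℝ}
    (hs0 : 0 < s) {L : ℝ≥0} (hL : 1 < L) {A : Set (EuclideanSpace ℝ (Fin N))}
    (hA : MeasurableSet A) (hAΩ : A ⊆ Ω) (hA0 : volume A ≠ 0) :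
    ∃ φ, IsTestFunction Ω φ ∧ (∀ x, 0 ≤ φ x) ∧ ∫⁻ x, ‖φ x‖ₑ ≠ 0 ∧
      gagliardo s 1 φ / ∫⁻ x, ‖φ x‖ₑ ≤ distortion N s L * (sPerimeter s A / volume A) := by
  have hL0 : 0 < L := zero_lt_one.trans hL
  obtain ⟨Φ, ρ, h1, h2, h3⟩ := exists_regularization hbdd hopen hlip hL
  have hAfin : volume A ≠ ⊤ :=
    ne_top_of_le_ne_top hbdd.measure_lt_top.ne (measure_mono hAΩ)
  let w : EuclideanSpace ℝ (Fin N) → ℝ := A.indicator fun _ => (1 : ℝ)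
  have hwm : Measurable w := measurable_const.indicator hA
  have hw : Integrable w := (integrable_indicator_iff hA).2 (integrableOn_const hAfin)
  have hw0 : ∀ x, 0 ≤ w x := fun x => indicator_nonneg (fun _ _ => zero_le_one) x
  have hwnorm : ∫⁻ x, ‖w x‖ₑ = volume A := by
    simp only [w, enorm_indicator_eq_indicator_enorm, enorm_one]
    exact lintegral_indicator_one hA
  have hwΦ := integrable_comp_symm h1 hwm hw
  have hwΦm : Measurable fun x => w (Φ.symm x) := hwm.comp Φ.symm.continuous.measurable
  have hmass : volume A ≤ (L : ℝ≥0∞) ^ N * ∫⁻ x, ‖w (Φ.symm x)‖ₑ := by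
    rw [← hwnorm]
    exact lintegral_le_lintegral_comp h2 (fun x => ‖w x‖ₑ)
  have hφtest := h3 w hwΦ fun x hx => indicator_of_notMem (fun h => hx (hAΩ h)) _
  have hφnorm := lintegral_enorm_mollify ρ hwΦ (fun x => hw0 _)
  refine ⟨mollify ρ fun x => w (Φ.symm x), hφtest, mollify_nonneg ρ fun x => hw0 _, ?_, ?_⟩
  · rw [hφnorm]
    intro h
    rw [h, mul_zero] at hmass
    exact hA0 (le_antisymm hmass zero_le)
  · have henergy : gagliardo s 1 (mollify ρ fun x => w (Φ.symm x)) ≤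
        (L : ℝ≥0∞) ^ N * ((L : ℝ≥0∞) ^ N * (L : ℝ≥0∞) ^ ((N : ℝ) + s)) * sPerimeter s A := by
      have hmod := lintegral_truncatedKernel_comp_symm_le (η := -1) hs0 hL h1 h2 w
      have hneg : (-1 : ℝ) / L < 0 := div_neg_of_neg_of_pos (by norm_num) (by exact_mod_cast hL0)
      rw [truncatedKernel_of_neg (by norm_num), truncatedKernel_of_neg hneg,
        lintegral_lintegral_diff_mul_kernel hwΦm (measurable_singularKernel s),
        ← gagliardo_one] at hmod
      refine le_trans ?_ hmod
      rw [gagliardo_one_eq hφtest.1.continuous.measurable]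
      gcongr with z
      exact translationModulus_mollify_le ρ hwΦ hwΦm z
    rw [hφnorm]
    have hLN : (L : ℝ≥0∞) ^ N ≠ 0 := by simp [hL0.ne']
    have hLN' : (L : ℝ≥0∞) ^ N ≠ ⊤ := by finiteness
    have hmass' : (∫⁻ x, ‖w (Φ.symm x)‖ₑ)⁻¹ ≤ (L : ℝ≥0∞) ^ N * (volume A)⁻¹ := by
      calc (∫⁻ x, ‖w (Φ.symm x)‖ₑ)⁻¹
          = (L : ℝ≥0∞) ^ N * ((L : ℝ≥0∞) ^ N * ∫⁻ x, ‖w (Φ.symm x)‖ₑ)⁻¹ := by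
            rw [ENNReal.mul_inv (Or.inl hLN) (Or.inl hLN'), ← mul_assoc,
              ENNReal.mul_inv_cancel hLN hLN', one_mul]
        _ ≤ _ := by gcongr
    rw [div_eq_mul_inv, div_eq_mul_inv, distortion]
    calc _ ≤ (L : ℝ≥0∞) ^ N * ((L : ℝ≥0∞) ^ N * (L : ℝ≥0∞) ^ ((N : ℝ) + s)) * sPerimeter s A *
          ((L : ℝ≥0∞) ^ N * (volume A)⁻¹) := by gcongr
      _ = _ := by ring

lemma exists_enorm_sub_le_rpow {s : ℝ} (hs0 : 0 < s) (hs1 : s < 1)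
    {φ : EuclideanSpace ℝ (Fin N) → ℝ} (hφ : ContDiff ℝ ∞ φ) (hc : HasCompactSupport φ) :
    ∃ M : ℝ≥0, 0 < M ∧ ∀ x y, ‖φ x - φ y‖ₑ ≤ M * ‖x - y‖ₑ ^ s := by
  obtain ⟨C, hC⟩ := ContDiff.lipschitzWith_of_hasCompactSupport hc hφ (by simp)
  obtain ⟨B, hB⟩ := hc.exists_bound_of_continuous hφ.continuous
  have hB' : ∀ x, ‖φ x‖ₑ ≤ B.toNNReal := fun x => by
    rw [← ofReal_norm]; exact ENNReal.ofReal_le_ofReal (hB x)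
  -- `C` serves for `|x - y| ≤ 1`, where `|x - y| ≤ |x - y|^s`, and `2B` beyond. The summand `1`
  -- keeps `M` positive, so that `M^(p-1) → 1`.
  refine ⟨C + (B.toNNReal + B.toNNReal) + 1, by positivity, fun x y => ?_⟩
  push_cast
  rcases le_total ‖x - y‖ₑ 1 with h | h
  · calc ‖φ x - φ y‖ₑ ≤ C * ‖x - y‖ₑ := by
          have := hC.edist_le_mul x y
          rwa [edist_eq_enorm_sub, edist_eq_enorm_sub] at this
      _ ≤ C * ‖x - y‖ₑ ^ s := by
          gcongr
          simpa using ENNReal.rpow_le_rpow_of_exponent_ge h hs1.le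
      _ ≤ _ := by
          gcongr
          rw [add_assoc]
          exact le_self_add
  · calc ‖φ x - φ y‖ₑ ≤ ‖φ x‖ₑ + ‖φ y‖ₑ := enorm_sub_le
      _ ≤ B.toNNReal + B.toNNReal := add_le_add (hB' x) (hB' y)
      _ ≤ (C + (B.toNNReal + B.toNNReal) + 1) * 1 := by
          rw [mul_one]
          exact le_add_self.trans le_self_add
      _ ≤ _ := by
          gcongr
          exact ENNReal.one_le_rpow h hs0

/-- Bounding `|φ x - φ y|^(p-1)` by the Hölder estimate produces `|x - y|^(s(p-1))`, exactly the
excess of the exponent `N + sp` over `N + s`. -/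
lemma gagliardo_rpow_le {s p : ℝ} (hp : 1 ≤ p) {φ : EuclideanSpace ℝ (Fin N) → ℝ} {M : ℝ≥0}
    (hM : ∀ x y, ‖φ x - φ y‖ₑ ≤ M * ‖x - y‖ₑ ^ s) :
    gagliardo s p φ ^ p ≤ (M : ℝ≥0∞) ^ (p - 1) * gagliardo s 1 φ := by
  have hMtop : (M : ℝ≥0∞) ^ (p - 1) ≠ ⊤ :=
    ENNReal.rpow_ne_top_of_nonneg (by linarith) ENNReal.coe_ne_top
  rw [gagliardo_rpow (by linarith), gagliardo_one, ← lintegral_const_mul' _ _ hMtop]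
  refine lintegral_mono fun x => ?_
  simp only
  rw [← lintegral_const_mul' _ _ hMtop]
  refine lintegral_mono fun y => ?_
  simp only
  by_cases hxy : x = y
  · simp [hxy, show 0 < p by linarith]
  have hr0 : ‖x - y‖ₑ ≠ 0 := by simpa [sub_eq_zero] using hxy
  have hrtop : ‖x - y‖ₑ ≠ ⊤ := enorm_ne_top
  rw [div_eq_mul_inv, singularKernel]
  set r := ‖x - y‖ₑ
  set d := ‖φ x - φ y‖ₑ
  have hd : d ^ p ≤ d * ((M : ℝ≥0∞) ^ (p - 1) * r ^ (s * (p - 1))) := by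
    have h1 : d ^ p = d * d ^ (p - 1) := by
      nth_rewrite 2 [← ENNReal.rpow_one d]
      rw [← ENNReal.rpow_add_of_nonneg _ _ zero_le_one (by linarith)]
      congr 1
      ring
    rw [h1, ENNReal.rpow_mul, ← ENNReal.mul_rpow_of_nonneg _ _ (by linarith)]
    gcongr
    exact hM x y
  have hr : r ^ (s * (p - 1)) * (r ^ ((N : ℝ) + s * p))⁻¹ = (r ^ ((N : ℝ) + s))⁻¹ := by
    rw [← ENNReal.rpow_neg, ← ENNReal.rpow_neg, ← ENNReal.rpow_add _ _ hr0 hrtop]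
    congr 1
    ring
  calc d ^ p * (r ^ ((N : ℝ) + s * p))⁻¹
      ≤ d * ((M : ℝ≥0∞) ^ (p - 1) * r ^ (s * (p - 1))) * (r ^ ((N : ℝ) + s * p))⁻¹ := by gcongr
    _ = (M : ℝ≥0∞) ^ (p - 1) * (d * (r ^ (s * (p - 1)) * (r ^ ((N : ℝ) + s * p))⁻¹)) := by ring
    _ = _ := by rw [hr]

lemma gagliardo_const_mul {s p c : ℝ} (hp : 0 < p) (u : EuclideanSpace ℝ (Fin N) → ℝ) :
    gagliardo s p (fun x => c * u x) ^ p = ‖c‖ₑ ^ p * gagliardo s p u ^ p := by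
  have hc : ‖c‖ₑ ^ p ≠ ⊤ := ENNReal.rpow_ne_top_of_nonneg hp.le enorm_ne_top
  rw [gagliardo_rpow hp, gagliardo_rpow hp, ← lintegral_const_mul' _ _ hc]
  refine lintegral_congr fun x => ?_
  rw [← lintegral_const_mul' _ _ hc]
  refine lintegral_congr fun y => ?_
  rw [← mul_sub, enorm_mul, ENNReal.mul_rpow_of_nonneg _ _ hp.le, mul_div_assoc]

lemma IsTestFunction.memSobolevZero {s p : ℝ} (hp : 0 < p) {Ω : Set (EuclideanSpace ℝ (Fin N))}
    {φ : EuclideanSpace ℝ (Fin N) → ℝ} (hφ : IsTestFunction Ω φ) : MemSobolevZero s p Ω φ := by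
  refine ⟨hφ.1.continuous.aemeasurable, ae_of_all _ fun x hx => ?_, fun ε hε => ⟨φ, hφ, ?_⟩⟩
  · exact image_eq_zero_of_notMem_tsupport fun h => hx (hφ.2.2 h)
  · simpa [gagliardo, normLp, hp] using hε

lemma IsTestFunction.const_mul {Ω : Set (EuclideanSpace ℝ (Fin N))}
    {φ : EuclideanSpace ℝ (Fin N) → ℝ} (hφ : IsTestFunction Ω φ) (c : ℝ) :
    IsTestFunction Ω fun x => c * φ x :=
  ⟨contDiff_const.mul hφ.1, hφ.2.1.mul_left, (tsupport_mul_subset_right).trans hφ.2.2⟩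

/-- The first eigenvalue is bounded by the Rayleigh quotient of any nonnegative test function. -/
lemma firstEigenvalue_le_div {s p : ℝ} (hp : 0 < p) {Ω : Set (EuclideanSpace ℝ (Fin N))}
    {φ : EuclideanSpace ℝ (Fin N) → ℝ} (hφ : IsTestFunction Ω φ) (hφ0 : ∀ x, 0 ≤ φ x)
    (h0 : normLp p Ω φ ≠ 0) (htop : normLp p Ω φ ≠ ⊤) :
    firstEigenvalue s p Ω ≤ gagliardo s p φ ^ p / normLp p Ω φ ^ p := by
  set m := normLp p Ω φ with hm
  have hmpos : 0 < m.toReal := ENNReal.toReal_pos h0 htop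
  have hc : ‖m.toReal⁻¹‖ₑ = m⁻¹ := by
    rw [Real.enorm_of_nonneg (by positivity), ENNReal.ofReal_inv_of_pos hmpos,
      ENNReal.ofReal_toReal htop]
  refine iInf₂_le_of_le (fun x => m.toReal⁻¹ * φ x) ((hφ.const_mul _).memSobolevZero hp)
    (iInf₂_le_of_le ?_ (ae_of_all _ fun x => mul_nonneg (by positivity) (hφ0 x)) ?_)
  · have := eLpNorm_const_smul (m.toReal⁻¹) φ (ENNReal.ofReal p) (volume.restrict Ω)
    change eLpNorm (m.toReal⁻¹ • φ) _ _ = 1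
    rw [this, hc]
    change m⁻¹ * m = 1
    exact ENNReal.inv_mul_cancel h0 htop
  · rw [gagliardo_const_mul hp, hc, ENNReal.inv_rpow, mul_comm, div_eq_mul_inv]

lemma normLp_one_eq_lintegral {Ω : Set (EuclideanSpace ℝ (Fin N))} (hΩ : MeasurableSet Ω)
    {u : EuclideanSpace ℝ (Fin N) → ℝ} (hu : ∀ x, x ∉ Ω → u x = 0) :
    normLp 1 Ω u = ∫⁻ x, ‖u x‖ₑ := by
  rw [normLp, ENNReal.ofReal_one, eLpNorm_one_eq_lintegral_enorm, ← lintegral_indicator hΩ]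
  refine lintegral_congr fun x => ?_
  by_cases hx : x ∈ Ω
  · rw [indicator_of_mem hx]
  · rw [indicator_of_notMem hx, hu x hx, enorm_zero]

/-- The upper bound: eventually the first eigenvalues lie below the Rayleigh quotient of any
nonnegative test function. -/
lemma eventually_firstEigenvalue_lt {Ω : Set (EuclideanSpace ℝ (Fin N))}
    (hbdd : Bornology.IsBounded Ω) (hopen : IsOpen Ω) (hne : Ω.Nonempty)
    {s : ℝ} (hs0 : 0 < s) (hs1 : s < 1) {φ : EuclideanSpace ℝ (Fin N) → ℝ}
    (hφ : IsTestFunction Ω φ) (hφ0 : ∀ x, 0 ≤ φ x) (hne0 : ∫⁻ x, ‖φ x‖ₑ ≠ 0) {b : ℝ≥0∞}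
    (hb : gagliardo s 1 φ / ∫⁻ x, ‖φ x‖ₑ < b) :
    ∀ᶠ p in 𝓝[>] (1 : ℝ), firstEigenvalue s p Ω < b := by
  obtain ⟨M, hM0, hM⟩ := exists_enorm_sub_le_rpow hs0 hs1 hφ.1 hφ.2.1
  have hV0 : volume Ω ≠ 0 := (hopen.measure_pos _ hne).ne'
  have hVtop : volume Ω ≠ ⊤ := hbdd.measure_lt_top.ne
  have hφΩ : ∀ x, x ∉ Ω → φ x = 0 := fun x hx =>
    image_eq_zero_of_notMem_tsupport fun h => hx (hφ.2.2 h)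
  have hItop : ∫⁻ x, ‖φ x‖ₑ ≠ ⊤ :=
    (hφ.1.continuous.integrable_of_hasCompactSupport hφ.2.1).2.ne
  set I := ∫⁻ x, ‖φ x‖ₑ with hI
  have hbound : ∀ p : ℝ, 1 < p → firstEigenvalue s p Ω ≤
      ((M : ℝ≥0∞) * volume Ω) ^ (p - 1) * (gagliardo s 1 φ * (I ^ p)⁻¹) := by
    intro p hp
    have hp0 : 0 < p := by linarith
    -- Hölder on the finite measure space `Ω`: the lower bound on the denominator of the
    -- `p`-quotient.
    have hhold : I ≤ normLp p Ω φ * volume Ω ^ (1 - 1 / p) := by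
      rw [hI, ← normLp_one_eq_lintegral hopen.measurableSet hφΩ]
      have := eLpNorm_le_eLpNorm_mul_rpow_measure_univ (μ := volume.restrict Ω)
        (p := ENNReal.ofReal 1) (q := ENNReal.ofReal p) (f := φ)
        (ENNReal.ofReal_le_ofReal hp.le) hφ.1.continuous.aestronglyMeasurable
      simpa [normLp, ENNReal.toReal_ofReal hp0.le] using this
    have hn0 : normLp p Ω φ ≠ 0 := by
      intro h
      rw [h, zero_mul] at hhold
      exact hne0 (le_antisymm hhold zero_le)
    have hntop : normLp p Ω φ ≠ ⊤ :=
      ((hφ.1.continuous.memLp_of_hasCompactSupport hφ.2.1).restrict Ω).eLpNorm_ne_top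
    have hVp0 : volume Ω ^ (p - 1) ≠ 0 := by
      simp [ENNReal.rpow_eq_zero_iff, hV0, hVtop]
    have hVptop : volume Ω ^ (p - 1) ≠ ⊤ :=
      ENNReal.rpow_ne_top_of_nonneg (by linarith) hVtop
    have hpow : I ^ p ≤ normLp p Ω φ ^ p * volume Ω ^ (p - 1) := by
      calc I ^ p ≤ (normLp p Ω φ * volume Ω ^ (1 - 1 / p)) ^ p := by gcongr
        _ = _ := by
          rw [ENNReal.mul_rpow_of_nonneg _ _ hp0.le, ← ENNReal.rpow_mul]
          congr 2
          field_simp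
    have hinv : (normLp p Ω φ ^ p)⁻¹ ≤ volume Ω ^ (p - 1) * (I ^ p)⁻¹ := by
      calc (normLp p Ω φ ^ p)⁻¹ = volume Ω ^ (p - 1) *
          (normLp p Ω φ ^ p * volume Ω ^ (p - 1))⁻¹ := by
            rw [ENNReal.mul_inv (Or.inr hVptop) (Or.inr hVp0), mul_left_comm,
              ENNReal.mul_inv_cancel hVp0 hVptop, mul_one]
        _ ≤ _ := by gcongr
    refine (firstEigenvalue_le_div hp0 hφ hφ0 hn0 hntop).trans ?_
    rw [div_eq_mul_inv]
    calc _ ≤ (M : ℝ≥0∞) ^ (p - 1) * gagliardo s 1 φ * (volume Ω ^ (p - 1) * (I ^ p)⁻¹) := by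
          gcongr
          exact gagliardo_rpow_le hp.le hM
      _ = _ := by
          rw [ENNReal.mul_rpow_of_nonneg _ _ (by linarith)]
          ring
  have hrpow : ∀ a : ℝ≥0∞, a ≠ 0 → a ≠ ⊤ → Continuous fun t : ℝ => a ^ t := by
    intro a ha0 hatop
    lift a to ℝ≥0 using hatop
    have ha : a ≠ 0 := by exact_mod_cast ha0
    simp_rw [← ENNReal.coe_rpow_of_ne_zero ha]
    have h : Continuous fun t : ℝ => (a : ℝ) ^ t :=
      Real.continuous_const_rpow (by exact_mod_cast ha)
    refine ENNReal.continuous_coe.comp (continuous_induced_rng.2 (h.congr fun t => ?_))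
    exact (NNReal.coe_rpow a t).symm
  have hMV0 : (M : ℝ≥0∞) * volume Ω ≠ 0 := mul_ne_zero (by exact_mod_cast hM0.ne') hV0
  have hMVtop : (M : ℝ≥0∞) * volume Ω ≠ ⊤ := by finiteness
  have hlim : Tendsto (fun p : ℝ => ((M : ℝ≥0∞) * volume Ω) ^ (p - 1) *
      (gagliardo s 1 φ * (I ^ p)⁻¹)) (𝓝[>] 1) (𝓝 (gagliardo s 1 φ / I)) := by
    have t1 : Tendsto (fun p : ℝ => ((M : ℝ≥0∞) * volume Ω) ^ (p - 1)) (𝓝 1) (𝓝 1) := by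
      have h : Continuous fun p : ℝ => ((M : ℝ≥0∞) * volume Ω) ^ (p - 1) :=
        (hrpow _ hMV0 hMVtop).comp (g := fun t : ℝ => ((M : ℝ≥0∞) * volume Ω) ^ t)
          (continuous_id.sub continuous_const)
      simpa using h.tendsto 1
    have t2 : Tendsto (fun p : ℝ => (I ^ p)⁻¹) (𝓝 1) (𝓝 I⁻¹) := by
      have h : Continuous fun p : ℝ => (I ^ p)⁻¹ := (hrpow _ hne0 hItop).inv
      have := h.tendsto 1
      rwa [ENNReal.rpow_one] at this
    have hI0 : I⁻¹ ≠ 0 := ENNReal.inv_ne_zero.2 hItop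
    have hItop' : I⁻¹ ≠ ⊤ := ENNReal.inv_ne_top.2 hne0
    have t3 := ENNReal.Tendsto.const_mul (a := gagliardo s 1 φ) t2 (Or.inl hI0)
    have t4 := ENNReal.Tendsto.mul t1 (Or.inl one_ne_zero) t3 (Or.inr ENNReal.one_ne_top)
    rw [one_mul, ← div_eq_mul_inv] at t4
    exact t4.mono_left nhdsWithin_le_nhds
  filter_upwards [hlim.eventually (gt_mem_nhds hb), self_mem_nhdsWithin] with p h1 h2
  exact (hbound p h2).trans_lt h1

end Upper

/-! ### The lower bound -/

section Lower

variable {N : ℕ}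

/-- For `b ≤ a`, convexity gives `a^p - b^p ≤ p (a - b) a^(p-1)`, and Young's inequality splits `(a
- b) θ · a^(p-1)`. What matters is that the error carries the factor `p - 1`. -/
lemma abs_rpow_sub_rpow_mul_le {a b θ p : ℝ} (ha : 0 ≤ a) (hb : 0 ≤ b) (hθ : 0 ≤ θ)
    (hp : 1 < p) : |a ^ p - b ^ p| * θ ≤ |a - b| ^ p * θ ^ p + (p - 1) * (a ^ p + b ^ p) := by
  have young : ∀ x y : ℝ, 0 ≤ x → 0 ≤ y → p * (x * y ^ (p - 1)) ≤ x ^ p + (p - 1) * y ^ p := by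
    intro x y hx hy
    have hp0 : 0 < p := by linarith
    have hp1 : 0 < p - 1 := by linarith
    have hpq : p.HolderConjugate (p / (p - 1)) := Real.HolderConjugate.conjExponent hp
    have h := Real.young_inequality_of_nonneg hx (Real.rpow_nonneg hy (p - 1)) hpq
    rw [← Real.rpow_mul hy, mul_div_cancel₀ _ hp1.ne'] at h
    calc p * (x * y ^ (p - 1)) ≤ p * (x ^ p / p + y ^ p / (p / (p - 1))) := by gcongr
      _ = _ := by field_simp
  have main : ∀ a b : ℝ, 0 ≤ b → b ≤ a →
      |a ^ p - b ^ p| * θ ≤ |a - b| ^ p * θ ^ p + (p - 1) * (a ^ p + b ^ p) := by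
    intro a b hb hab
    have ha : 0 ≤ a := hb.trans hab
    have hpow : b ^ p ≤ a ^ p := Real.rpow_le_rpow hb hab (by linarith)
    have haa : a ^ p = a * a ^ (p - 1) := by
      rcases ha.eq_or_lt with h | h
      · rw [← h, Real.zero_rpow (by linarith), zero_mul]
      · rw [← Real.rpow_one_add' ha (by linarith)]
        congr 1
        ring
    have h1 := young b a hb ha
    have h2 := young ((a - b) * θ) a (mul_nonneg (by linarith) hθ) ha
    rw [Real.mul_rpow (by linarith) hθ] at h2
    rw [abs_of_nonneg (by linarith), abs_of_nonneg (by linarith)]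
    have h3 : a ^ p - b ^ p ≤ p * ((a - b) * a ^ (p - 1)) := by
      have : p * ((a - b) * a ^ (p - 1)) = p * a ^ p - p * (b * a ^ (p - 1)) := by
        rw [haa]; ring
      rw [this]; linarith
    have h4 := mul_le_mul_of_nonneg_right h3 hθ
    have h5 : 0 ≤ (p - 1) * b ^ p := mul_nonneg (by linarith) (Real.rpow_nonneg hb p)
    calc _ ≤ p * ((a - b) * a ^ (p - 1)) * θ := h4
      _ = p * ((a - b) * θ * a ^ (p - 1)) := by ring
      _ ≤ _ := by rw [mul_add]; linarith
  rcases le_total b a with h | h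
  · exact main a b hb h
  · have := main b a ha h
    rwa [abs_sub_comm, abs_sub_comm b a, add_comm (b ^ p)] at this

/-- The pointwise comparison of the energy of `u ^ p` with the `p`-energy of `u`. -/
lemma enorm_rpow_sub_mul_truncatedKernel_le {s p η R : ℝ} (hp : 1 < p) (hη : 0 < η)
    {a b : ℝ} (ha : 0 ≤ a) (hb : 0 ≤ b) (z : EuclideanSpace ℝ (Fin N)) :
    ‖a ^ p - b ^ p‖ₑ * truncatedKernel s η z ≤
      ‖a - b‖ₑ ^ p / ‖z‖ₑ ^ ((N : ℝ) + s * p) + (‖a ^ p‖ₑ + ‖b ^ p‖ₑ) *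
        ((Metric.closedBall 0 R).indicator
            (fun _ => ENNReal.ofReal (p - 1) * (ENNReal.ofReal (η ^ N))⁻¹) z +
          {z | R < ‖z‖}.indicator (singularKernel s) z) := by
  by_cases hz : η < ‖z‖
  swap
  · rw [truncatedKernel, indicator_of_notMem (show z ∉ {z | η < ‖z‖} from hz), mul_zero]
    exact zero_le
  rw [truncatedKernel, indicator_of_mem (show z ∈ {z | η < ‖z‖} from hz)]
  by_cases hR : R < ‖z‖
  · refine le_trans ?_ le_add_self
    rw [indicator_of_mem (show z ∈ {z | R < ‖z‖} from hR)]
    gcongr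
    · exact enorm_sub_le
    · exact le_add_self
  · rw [indicator_of_mem (show z ∈ Metric.closedBall 0 R by simpa using hR),
      indicator_of_notMem (show z ∉ {z | R < ‖z‖} from hR), add_zero]
    have hr : 0 < ‖z‖ := hη.trans hz
    set r := ‖z‖ with hrdef
    have hpinv : 0 ≤ p - 1 := by linarith
    have hap : 0 ≤ a ^ p := Real.rpow_nonneg ha p
    have hbp : 0 ≤ b ^ p := Real.rpow_nonneg hb p
    have hNpos : 0 < η ^ N := pow_pos hη N
    have hreal : |a ^ p - b ^ p| * (r ^ ((N : ℝ) + s))⁻¹ ≤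
        |a - b| ^ p * (r ^ ((N : ℝ) + s * p))⁻¹ + (a ^ p + b ^ p) * ((p - 1) * (η ^ N)⁻¹) := by
      -- After division by `r^N`, the choice `θ = r^(-s)` yields the `W^{s,1}` kernel on the left
      -- and the `W^{s,p}` kernel on the right; the error kernel `r^(-N)` is at most `η^(-N)`.
      have h := abs_rpow_sub_rpow_mul_le (θ := r ^ (-s)) ha hb (Real.rpow_nonneg hr.le _) hp
      have h1 : (r ^ ((N : ℝ) + s))⁻¹ = r ^ (-s) * (r ^ N)⁻¹ := by
        rw [Real.rpow_add hr, Real.rpow_natCast, Real.rpow_neg hr.le, mul_inv, mul_comm]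
      have h2 : (r ^ ((N : ℝ) + s * p))⁻¹ = (r ^ (-s)) ^ p * (r ^ N)⁻¹ := by
        rw [Real.rpow_add hr, Real.rpow_natCast, ← Real.rpow_mul hr.le, neg_mul,
          Real.rpow_neg hr.le, mul_inv, mul_comm]
      have h3 : (r ^ N)⁻¹ ≤ (η ^ N)⁻¹ := by gcongr
      rw [h1, h2]
      calc |a ^ p - b ^ p| * (r ^ (-s) * (r ^ N)⁻¹)
          = (|a ^ p - b ^ p| * r ^ (-s)) * (r ^ N)⁻¹ := by ring
        _ ≤ (|a - b| ^ p * (r ^ (-s)) ^ p + (p - 1) * (a ^ p + b ^ p)) * (r ^ N)⁻¹ := by gcongr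
        _ = |a - b| ^ p * ((r ^ (-s)) ^ p * (r ^ N)⁻¹) +
            (a ^ p + b ^ p) * ((p - 1) * (r ^ N)⁻¹) := by ring
        _ ≤ _ := by gcongr
    have h := ENNReal.ofReal_le_ofReal hreal
    rw [ENNReal.ofReal_add (by positivity) (by positivity), ENNReal.ofReal_mul (abs_nonneg _),
      ENNReal.ofReal_mul (by positivity), ENNReal.ofReal_mul (by positivity),
      ENNReal.ofReal_mul hpinv, ENNReal.ofReal_add hap hbp,
      ENNReal.ofReal_inv_of_pos (by positivity), ENNReal.ofReal_inv_of_pos (by positivity),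
      ENNReal.ofReal_inv_of_pos hNpos, ← ENNReal.ofReal_rpow_of_pos hr,
      ← ENNReal.ofReal_rpow_of_pos hr, ← ENNReal.ofReal_rpow_of_nonneg (abs_nonneg _)
        (by linarith), hrdef, ofReal_norm, ← Real.enorm_eq_ofReal_abs,
      ← Real.enorm_eq_ofReal_abs, ← Real.enorm_of_nonneg hap, ← Real.enorm_of_nonneg hbp] at h
    exact h

/-- The truncated energy of `u ^ p` is controlled by the `p`-energy of `u`. -/
lemma lintegral_rpow_truncatedKernel_le {s p η R : ℝ} (hp : 1 < p) (hη : 0 < η)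
    {u : EuclideanSpace ℝ (Fin N) → ℝ} (hu : Measurable u) (hu0 : ∀ x, 0 ≤ u x) :
    ∫⁻ x, ∫⁻ y, ‖u x ^ p - u y ^ p‖ₑ * truncatedKernel s η (x - y) ≤
      gagliardo s p u ^ p + 2 * (∫⁻ x, ‖u x ^ p‖ₑ) *
        (ENNReal.ofReal (p - 1) * (ENNReal.ofReal (η ^ N))⁻¹ *
            volume (Metric.closedBall (0 : EuclideanSpace ℝ (Fin N)) R) +
          ∫⁻ z in {z : EuclideanSpace ℝ (Fin N) | R < ‖z‖}, singularKernel s z) := by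
  let κ : EuclideanSpace ℝ (Fin N) → ℝ≥0∞ := fun z => (Metric.closedBall 0 R).indicator
      (fun _ => ENNReal.ofReal (p - 1) * (ENNReal.ofReal (η ^ N))⁻¹) z +
        {z | R < ‖z‖}.indicator (singularKernel s) z
  have hRm : MeasurableSet {z : EuclideanSpace ℝ (Fin N) | R < ‖z‖} :=
    measurableSet_lt (by fun_prop) (by fun_prop)
  have hB : MeasurableSet (Metric.closedBall (0 : EuclideanSpace ℝ (Fin N)) R) :=
    Metric.isClosed_closedBall.measurableSet
  have hκ1 : Measurable fun z : EuclideanSpace ℝ (Fin N) => {z | R < ‖z‖}.indicator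
      (singularKernel s) z := (measurable_singularKernel s).indicator hRm
  have hκm : Measurable κ := (measurable_const.indicator hB).add hκ1
  have hκ : ∫⁻ z, κ z = ENNReal.ofReal (p - 1) * (ENNReal.ofReal (η ^ N))⁻¹ *
            volume (Metric.closedBall (0 : EuclideanSpace ℝ (Fin N)) R) +
          ∫⁻ z in {z : EuclideanSpace ℝ (Fin N) | R < ‖z‖}, singularKernel s z := by
    rw [lintegral_add_right _ hκ1, lintegral_indicator_const hB, lintegral_indicator hRm]
  have hup : Measurable fun x => u x ^ p := hu.pow_const p
  have hx : ∫⁻ x, ∫⁻ y, ‖u x ^ p‖ₑ * κ (x - y) = (∫⁻ x, ‖u x ^ p‖ₑ) * ∫⁻ z, κ z := by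
    rw [← lintegral_mul_const _ (by fun_prop)]
    refine lintegral_congr fun x => ?_
    rw [lintegral_const_mul _ (by fun_prop), lintegral_sub_left_eq_self]
  have hy : ∫⁻ x, ∫⁻ y, ‖u y ^ p‖ₑ * κ (x - y) = (∫⁻ x, ‖u x ^ p‖ₑ) * ∫⁻ z, κ z := by
    rw [lintegral_lintegral_swap (by fun_prop), ← lintegral_mul_const _ (by fun_prop)]
    refine lintegral_congr fun y => ?_
    rw [lintegral_const_mul _ (by fun_prop), lintegral_sub_right_eq_self κ y]
  calc _ ≤ ∫⁻ x, ∫⁻ y, (‖u x - u y‖ₑ ^ p / ‖x - y‖ₑ ^ ((N : ℝ) + s * p) +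
        (‖u x ^ p‖ₑ * κ (x - y) + ‖u y ^ p‖ₑ * κ (x - y))) := by
        refine lintegral_mono fun x => lintegral_mono fun y => ?_
        simp only
        rw [← add_mul]
        exact enorm_rpow_sub_mul_truncatedKernel_le hp hη (hu0 x) (hu0 y) _
    _ = (∫⁻ x, ∫⁻ y, ‖u x - u y‖ₑ ^ p / ‖x - y‖ₑ ^ ((N : ℝ) + s * p)) +
        ((∫⁻ x, ∫⁻ y, ‖u x ^ p‖ₑ * κ (x - y)) + ∫⁻ x, ∫⁻ y, ‖u y ^ p‖ₑ * κ (x - y)) := by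
        have h1 : Measurable fun q : EuclideanSpace ℝ (Fin N) × EuclideanSpace ℝ (Fin N) =>
            ‖u q.1 ^ p‖ₑ * κ (q.1 - q.2) + ‖u q.2 ^ p‖ₑ * κ (q.1 - q.2) := by fun_prop
        have h2 : Measurable fun q : EuclideanSpace ℝ (Fin N) × EuclideanSpace ℝ (Fin N) =>
            ‖u q.2 ^ p‖ₑ * κ (q.1 - q.2) := by fun_prop
        rw [← lintegral_add_right _ h2.lintegral_prod_right']
        have h3 : ∀ x, (∫⁻ y, ‖u x ^ p‖ₑ * κ (x - y)) + ∫⁻ y, ‖u y ^ p‖ₑ * κ (x - y) =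
            ∫⁻ y, (‖u x ^ p‖ₑ * κ (x - y) + ‖u y ^ p‖ₑ * κ (x - y)) := fun x =>
          (lintegral_add_right _ (by fun_prop)).symm
        simp_rw [h3]
        rw [← lintegral_add_right _ h1.lintegral_prod_right']
        refine lintegral_congr fun x => ?_
        rw [lintegral_add_right _ (by fun_prop)]
    _ = _ := by
        rw [hx, hy, hκ, gagliardo_rpow (by linarith)]
        ring

/-- The Cheeger inequality for integrable functions, with the energy truncated near the
diagonal. -/
lemma exists_cheegerConstant_mul_le {Ω : Set (EuclideanSpace ℝ (Fin N))}
    (hbdd : Bornology.IsBounded Ω) (hopen : IsOpen Ω) (hlip : HasLipschitzBoundary Ω) {s : ℝ}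
    (hs0 : 0 < s) {L : ℝ≥0} (hL : 1 < L) :
    ∃ M : ℝ≥0∞, M ≠ ⊤ ∧ ∀ (η : ℝ) (w : EuclideanSpace ℝ (Fin N) → ℝ), Measurable w →
      Integrable w → (∀ x, 0 ≤ w x) → (∀ x, x ∉ Ω → w x = 0) →
      cheegerConstant s Ω * ∫⁻ x, ‖w x‖ₑ ≤
        M * (∫⁻ x, ‖w x‖ₑ) *
          (∫⁻ z in {z : EuclideanSpace ℝ (Fin N) | ‖z‖ ≤ η}, ‖z‖ₑ * singularKernel s z) +
        distortion N s L *
          ∫⁻ x, ∫⁻ y, ‖w x - w y‖ₑ * truncatedKernel s (η / L) (x - y) := by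
  obtain ⟨Φ, ρ, h1, h2, h3⟩ := exists_regularization hbdd hopen hlip hL
  obtain ⟨M, hM, hMz⟩ := exists_translationModulus_normed_le ρ
  -- One `L^N` comes from recovering the mass of `w` from that of `v`, the other from the mass of
  -- the deformed `w`. The constant does not depend on `η`, which can therefore be chosen
  -- afterwards.
  refine ⟨(L : ℝ≥0∞) ^ N * (M * (L : ℝ≥0∞) ^ N), by finiteness, fun η w hwm hw hw0 hwΩ => ?_⟩
  have hwΦ := integrable_comp_symm h1 hwm hw
  have hwΦm : Measurable fun x => w (Φ.symm x) := hwm.comp Φ.symm.continuous.measurable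
  have hφtest := h3 w hwΦ hwΩ
  have hφnorm := lintegral_enorm_mollify ρ hwΦ (fun x => hw0 _)
  set v := mollify ρ fun x => w (Φ.symm x) with hv
  have hvm : Measurable v := hφtest.1.continuous.measurable
  have hcheeger := cheegerConstant_mul_lintegral_le (s := s) hbdd.measure_lt_top.ne hvm
    (mollify_nonneg ρ fun x => hw0 _) (fun x hx =>
      image_eq_zero_of_notMem_tsupport fun h => hx (hφtest.2.2 h))
  have hnear : MeasurableSet {z : EuclideanSpace ℝ (Fin N) | ‖z‖ ≤ η} :=
    measurableSet_le (by fun_prop) (by fun_prop)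
  have hwΦnorm : ∫⁻ x, ‖w (Φ.symm x)‖ₑ ≤ (L : ℝ≥0∞) ^ N * ∫⁻ x, ‖w x‖ₑ :=
    lintegral_enorm_comp_symm_le h1 w
  -- Inside the ball `|z| ≤ η` the smoothness of the mollifier is used; outside, mollification does
  -- not increase the modulus and the deformation estimate applies.
  have hsplit : gagliardo s 1 v ≤
      M * ((L : ℝ≥0∞) ^ N * ∫⁻ x, ‖w x‖ₑ) *
        (∫⁻ z in {z : EuclideanSpace ℝ (Fin N) | ‖z‖ ≤ η}, ‖z‖ₑ * singularKernel s z) +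
      (L : ℝ≥0∞) ^ N * ((L : ℝ≥0∞) ^ N * (L : ℝ≥0∞) ^ ((N : ℝ) + s)) *
        ∫⁻ x, ∫⁻ y, ‖w x - w y‖ₑ * truncatedKernel s (η / L) (x - y) := by
    have hcompl : {z : EuclideanSpace ℝ (Fin N) | ‖z‖ ≤ η}ᶜ = {z | η < ‖z‖} := by
      ext z; simp
    rw [gagliardo_one_eq hvm, ← lintegral_add_compl _ hnear, hcompl]
    refine add_le_add ?_ ?_
    · rw [← lintegral_const_mul _ (by fun_prop)]
      refine lintegral_mono fun z => ?_
      simp only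
      rw [← mul_assoc]
      gcongr
      calc translationModulus v z
          ≤ translationModulus (ρ.normed volume) z * ∫⁻ x, ‖w (Φ.symm x)‖ₑ :=
            translationModulus_mollify_le_mul ρ hwΦ hwΦm z
        _ ≤ (M * ‖z‖ₑ) * ((L : ℝ≥0∞) ^ N * ∫⁻ x, ‖w x‖ₑ) := by
            gcongr
            exact hMz z
        _ = _ := by ring
    · refine le_trans ?_ (lintegral_truncatedKernel_comp_symm_le hs0 hL h1 h2 w)
      rw [lintegral_lintegral_diff_mul_kernel hwΦm (measurable_truncatedKernel s η),
        ← lintegral_indicator (measurableSet_lt (by fun_prop) (by fun_prop))]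
      refine lintegral_mono fun z => ?_
      by_cases hz : η < ‖z‖
      · rw [truncatedKernel, indicator_of_mem (show z ∈ {z | η < ‖z‖} from hz),
          indicator_of_mem (show z ∈ {z | η < ‖z‖} from hz)]
        gcongr
        exact translationModulus_mollify_le ρ hwΦ hwΦm z
      · rw [indicator_of_notMem (show z ∉ {z | η < ‖z‖} from hz)]
        exact zero_le
  have hmass : ∫⁻ x, ‖w x‖ₑ ≤ (L : ℝ≥0∞) ^ N * ∫⁻ x, ‖v x‖ₑ := by
    rw [hφnorm]
    exact lintegral_le_lintegral_comp h2 (fun x => ‖w x‖ₑ)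
  calc cheegerConstant s Ω * ∫⁻ x, ‖w x‖ₑ
      ≤ cheegerConstant s Ω * ((L : ℝ≥0∞) ^ N * ∫⁻ x, ‖v x‖ₑ) := by gcongr
    _ = (L : ℝ≥0∞) ^ N * (cheegerConstant s Ω * ∫⁻ x, ‖v x‖ₑ) := by ring
    _ ≤ _ := mul_le_mul_right (hcheeger.trans hsplit) _
    _ = _ := by rw [distortion]; ring

lemma gagliardo_congr_ae {s p : ℝ} {u v : EuclideanSpace ℝ (Fin N) → ℝ}
    (h : u =ᵐ[volume] v) : gagliardo s p u = gagliardo s p v := by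
  unfold gagliardo
  congr 1
  refine lintegral_congr_ae ?_
  filter_upwards [h] with x hx
  refine lintegral_congr_ae ?_
  filter_upwards [h] with y hy
  rw [hx, hy]

/-- The lower bound for the energy of the competitors in `firstEigenvalue`. -/
lemma exists_cheegerConstant_le {Ω : Set (EuclideanSpace ℝ (Fin N))}
    (hbdd : Bornology.IsBounded Ω) (hopen : IsOpen Ω) (hlip : HasLipschitzBoundary Ω) {s : ℝ}
    (hs0 : 0 < s) {L : ℝ≥0} (hL : 1 < L) :
    ∃ M : ℝ≥0∞, M ≠ ⊤ ∧ ∀ η R p : ℝ, 0 < η → 1 < p →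
      ∀ u : EuclideanSpace ℝ (Fin N) → ℝ, AEMeasurable u volume →
      (∀ᵐ x ∂volume, x ∉ Ω → u x = 0) → normLp p Ω u = 1 → (∀ᵐ x ∂volume, 0 ≤ u x) →
      cheegerConstant s Ω ≤
        M * (∫⁻ z in {z : EuclideanSpace ℝ (Fin N) | ‖z‖ ≤ η}, ‖z‖ₑ * singularKernel s z) +
        distortion N s L * (gagliardo s p u ^ p + 2 *
          (ENNReal.ofReal (p - 1) * (ENNReal.ofReal ((η / L) ^ N))⁻¹ *
            volume (Metric.closedBall (0 : EuclideanSpace ℝ (Fin N)) R) +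
          ∫⁻ z in {z : EuclideanSpace ℝ (Fin N) | R < ‖z‖}, singularKernel s z)) := by
  obtain ⟨M, hM, hMw⟩ := exists_cheegerConstant_mul_le hbdd hopen hlip hs0 hL
  refine ⟨M, hM, fun η R p hη hp u hum huΩ hnorm hu0 => ?_⟩
  have hp0 : 0 < p := by linarith
  have hL0 : (0 : ℝ) < L := by
    have : 0 < L := zero_lt_one.trans hL
    exact_mod_cast this
  -- A Borel representative that is nonnegative and vanishes off `Ω` at every point, as the
  -- inequality for `w = u'^p` requires.
  let u' : EuclideanSpace ℝ (Fin N) → ℝ := Ω.indicator fun x => max (hum.mk u x) 0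
  have hu'm : Measurable u' :=
    (hum.measurable_mk.max measurable_const).indicator hopen.measurableSet
  have hu'0 : ∀ x, 0 ≤ u' x := fun x => indicator_nonneg (fun _ _ => le_max_right _ _) x
  have hu'Ω : ∀ x, x ∉ Ω → u' x = 0 := fun x hx => indicator_of_notMem hx _
  have hae : u =ᵐ[volume] u' := by
    filter_upwards [hum.ae_eq_mk, huΩ, hu0] with x h1 h2 h3
    by_cases hx : x ∈ Ω
    · simp only [u', indicator_of_mem hx]
      rw [← h1, max_eq_left h3]
    · rw [hu'Ω x hx, h2 hx]
  have hnorm' : ∫⁻ x, ‖u' x ^ p‖ₑ = 1 := by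
    rw [normLp, eLpNorm_congr_ae (ae_restrict_of_ae hae),
      eLpNorm_eq_lintegral_rpow_enorm_toReal (by simpa using hp0) ENNReal.ofReal_ne_top,
      ENNReal.toReal_ofReal hp0.le] at hnorm
    have h1 : ∫⁻ x in Ω, ‖u' x‖ₑ ^ p = 1 := by
      have := congrArg (fun t : ℝ≥0∞ => t ^ p) hnorm
      simpa [← ENNReal.rpow_mul, hp0.ne'] using this
    rw [← h1, ← lintegral_indicator hopen.measurableSet]
    refine lintegral_congr fun x => ?_
    by_cases hx : x ∈ Ω
    · rw [indicator_of_mem hx, Real.enorm_rpow_of_nonneg (hu'0 x) hp0.le]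
    · rw [indicator_of_notMem hx, hu'Ω x hx, Real.zero_rpow hp0.ne', enorm_zero]
  have hwm : Measurable fun x => u' x ^ p := hu'm.pow_const p
  have hw : Integrable fun x => u' x ^ p :=
    ⟨hwm.aestronglyMeasurable, by rw [hasFiniteIntegral_iff_enorm, hnorm']; exact ENNReal.one_lt_top⟩
  have h := hMw η (fun x => u' x ^ p) hwm hw (fun x => Real.rpow_nonneg (hu'0 x) p)
    (fun x hx => by rw [hu'Ω x hx, Real.zero_rpow hp0.ne'])
  rw [hnorm', mul_one, mul_one] at h
  refine h.trans ?_
  gcongr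
  have h2 := lintegral_rpow_truncatedKernel_le (s := s) (R := R) hp (div_pos hη hL0) hu'm hu'0
  rwa [hnorm', mul_one, ← gagliardo_congr_ae hae] at h2

/-- The lower bound: eventually the first eigenvalues exceed any number below the Cheeger
constant. -/
lemma eventually_lt_firstEigenvalue (hN : 1 ≤ N) {Ω : Set (EuclideanSpace ℝ (Fin N))}
    (hbdd : Bornology.IsBounded Ω) (hopen : IsOpen Ω) (hlip : HasLipschitzBoundary Ω)
    {s : ℝ} (hs0 : 0 < s) (hs1 : s < 1) {a : ℝ≥0∞} (ha : a < cheegerConstant s Ω) :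
    ∀ᶠ p in 𝓝[>] (1 : ℝ), a < firstEigenvalue s p Ω := by
  -- Proving that every competitor has energy at least `a'` keeps the inequality with `a` strict
  -- after taking the infimum.
  obtain ⟨a', haa', ha'⟩ := exists_between ha
  obtain ⟨L, hL, hLa⟩ := exists_distortion_mul_lt (N := N) hs0 ha'
  obtain ⟨M, hM, hMu⟩ := exists_cheegerConstant_le hbdd hopen hlip hs0 hL
  have hL0 : (0 : ℝ) < L := by
    have : 0 < L := zero_lt_one.trans hL
    exact_mod_cast this
  set D := distortion N s L with hD
  have hDtop : D ≠ ⊤ := distortion_ne_top hs0 L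
  obtain ⟨b, hb1, hb2⟩ := exists_between hLa
  have hb0 : b - D * a' ≠ 0 := (tsub_pos_of_lt hb1).ne'
  -- The gap `b - D * a'` is shared equally by the near-diagonal, far and intermediate errors. A
  -- competitor of energy below `a'` would then force the Cheeger constant to be at most `b`, which
  -- lies strictly below it.
  have small : ∀ {C : ℝ≥0∞}, C ≠ ⊤ → ∃ δ : ℝ≥0∞, δ ≠ 0 ∧ C * δ ≤ (b - D * a') / 3 := by
    intro C hC
    refine ⟨(b - D * a') / 3 / C, ?_, ENNReal.mul_div_le⟩
    exact ENNReal.div_ne_zero.2 ⟨ENNReal.div_ne_zero.2 ⟨hb0, by simp⟩, hC⟩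
  obtain ⟨δ₁, hδ₁, hMδ⟩ := small hM
  obtain ⟨δ₂, hδ₂, hDδ⟩ := small (C := D * 2) (by finiteness)
  obtain ⟨η, hη, hnear⟩ := exists_lintegral_near_le hN hs0 hs1 hδ₁
  obtain ⟨R, hR, hfar⟩ := exists_lintegral_far_le hN hs0 hs1 hδ₂
  set C := (ENNReal.ofReal ((η / L) ^ N))⁻¹ *
    volume (Metric.closedBall (0 : EuclideanSpace ℝ (Fin N)) R) with hC
  have hCtop : C ≠ ⊤ := by
    refine ENNReal.mul_ne_top (ENNReal.inv_ne_top.2 ?_) measure_closedBall_lt_top.ne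
    have : 0 < (η / L) ^ N := pow_pos (div_pos hη hL0) N
    simpa using this
  have hlim : Tendsto (fun p : ℝ => D * 2 * C * ENNReal.ofReal (p - 1)) (𝓝[>] 1) (𝓝 0) := by
    have h1 : Tendsto (fun p : ℝ => ENNReal.ofReal (p - 1)) (𝓝 1) (𝓝 0) := by
      have h : Continuous fun p : ℝ => ENNReal.ofReal (p - 1) :=
        ENNReal.continuous_ofReal.comp (continuous_id.sub continuous_const)
      simpa using h.tendsto 1
    have h2 := ENNReal.Tendsto.const_mul (a := D * 2 * C) h1 (Or.inr (by finiteness))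
    rw [mul_zero] at h2
    exact h2.mono_left nhdsWithin_le_nhds
  have hthird : (0 : ℝ≥0∞) < (b - D * a') / 3 :=
    pos_iff_ne_zero.2 (ENNReal.div_ne_zero.2 ⟨hb0, by simp⟩)
  filter_upwards [hlim.eventually (gt_mem_nhds hthird), self_mem_nhdsWithin] with p hp1 hp
  refine haa'.trans_le (le_iInf₂ fun u hu => le_iInf₂ fun hnorm hu0 => ?_)
  by_contra hlt
  rw [not_le] at hlt
  have h := hMu η R p hη hp u hu.1 hu.2.1 hnorm hu0
  refine absurd (h.trans ?_) (not_le.2 hb2)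
  calc _ ≤ M * δ₁ + D * (a' + 2 * (ENNReal.ofReal (p - 1) * (ENNReal.ofReal ((η / L) ^ N))⁻¹ *
            volume (Metric.closedBall (0 : EuclideanSpace ℝ (Fin N)) R) + δ₂)) := by gcongr
    _ = D * a' + (M * δ₁ + D * 2 * C * ENNReal.ofReal (p - 1) + D * 2 * δ₂) := by
        rw [hC]; ring
    _ ≤ D * a' + ((b - D * a') / 3 + (b - D * a') / 3 + (b - D * a') / 3) := by gcongr
    _ = b := by rw [ENNReal.add_thirds, add_tsub_cancel_of_le hb1.le]

end Lower

/-- The coarea inequality for a bump function, which has positive mass and finite energy, excludes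
the value `⊤` without computing the perimeter of any set. -/
lemma cheegerConstant_ne_top {N : ℕ} (hN : 1 ≤ N) {Ω : Set (EuclideanSpace ℝ (Fin N))}
    (hne : Ω.Nonempty) (hopen : IsOpen Ω) (hbdd : Bornology.IsBounded Ω) {s : ℝ} (hs0 : 0 < s)
    (hs1 : s < 1) : cheegerConstant s Ω ≠ ⊤ := by
  obtain ⟨x, hx⟩ := hne
  obtain ⟨f, hfsupp, hfc, hf, hfrange, hfx⟩ :=
    exists_contDiff_tsupport_subset (n := ⊤) (hopen.mem_nhds hx)
  have hf0 : ∀ y, 0 ≤ f y := fun y => (hfrange ⟨y, rfl⟩).1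
  have h := cheegerConstant_mul_lintegral_le (s := s) hbdd.measure_lt_top.ne
    hf.continuous.measurable hf0
    (fun y hy => image_eq_zero_of_notMem_tsupport fun h => hy (hfsupp h))
  intro htop
  have hpos : ∫⁻ y, ‖f y‖ₑ ≠ 0 := by
    intro h0
    rw [lintegral_eq_zero_iff (by have := hf.continuous; fun_prop)] at h0
    have h1 : (fun y => ‖f y‖ₑ) = 0 :=
      Continuous.ae_eq_iff_eq volume (by have := hf.continuous; fun_prop) continuous_zero |>.1 h0
    have := congrFun h1 x
    simp [hfx] at this
  rw [htop, ENNReal.top_mul hpos, top_le_iff] at h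
  exact gagliardo_one_ne_top hN hs0 hs1 hf hfc h

end FracCheeger

end

/-- As `p → 1⁺`, the first nonlocal `p`-eigenvalues of a bounded Lipschitz open set converge to its
`s`-Cheeger constant, which is finite. -/
theorem mainTheorem2 (N : ℕ) (hN : 1 ≤ N) (Ω : Set (EuclideanSpace ℝ (Fin N)))
    (hΩ_ne : Ω.Nonempty) (hΩ_open : IsOpen Ω) (hΩ_bdd : Bornology.IsBounded Ω)
    (hΩ_lip : FracCheeger.HasLipschitzBoundary Ω) (s : ℝ) (hs0 : 0 < s) (hs1 : s < 1) :
    FracCheeger.cheegerConstant s Ω ≠ ⊤ ∧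
      Tendsto (fun p : ℝ => FracCheeger.firstEigenvalue s p Ω) (𝓝[>] 1)
        (𝓝 (FracCheeger.cheegerConstant s Ω)) := by
  refine ⟨FracCheeger.cheegerConstant_ne_top hN hΩ_ne hΩ_open hΩ_bdd hs0 hs1,
    tendsto_order.2 ⟨fun a ha => ?_, fun b hb => ?_⟩⟩
  · exact FracCheeger.eventually_lt_firstEigenvalue hN hΩ_bdd hΩ_open hΩ_lip hs0 hs1 ha
  · simp only [FracCheeger.cheegerConstant, iInf_lt_iff] at hb
    obtain ⟨A, hA, hAΩ, hA0, hAb⟩ := hb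
    obtain ⟨L, hL, hLb⟩ := FracCheeger.exists_distortion_mul_lt (N := N) hs0 hAb
    obtain ⟨φ, hφ, hφ0, hφne, hφle⟩ :=
      FracCheeger.exists_isTestFunction_gagliardo_le hΩ_bdd hΩ_open hΩ_lip hs0 hL hA hAΩ hA0
    exact FracCheeger.eventually_firstEigenvalue_lt hΩ_bdd hΩ_open hΩ_ne hs0 hs1 hφ hφ0 hφne
      (hφle.trans_lt hLb)
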